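/- Let $K$ be a field and let $q$ be a prime number with $q\neq\operatorname{char}(K)$. If $q=2$, assume that $K$ is not euclidean (that is, $K$ carries no field ordering in which every non-negative element is a square). Assume that $K$ contains a primitive $q$-th root of unity, and that $G:=(K^\times)^q=\{x^q : x\in K^\times\}$ satisfies $G\neq K^\times$ and $-1\in G$. Put \[ T:=G+1=\{g+1 : g\in G\},\qquad \mathcal N_G:=\Big\{\bigcap_{i=1}^n a_iT \;:\; n\in\mathbb N,\ a_1,\dots,a_n\in K^\times\Big\}. \] Assume that the following four conditions hold: (V1)$'$ $\{0\}\notin\mathcal N_G$; (V3)$'$ there is $V\in\mathcal N_G$ with $V-V\subseteq T$; (V4)$'$ there is $V\in\mathcal N_G$ with $V\cdot V\subseteq T$; (V6)$'$ there is $V\in\mathcal N_G$ such that for all $x,y\in K$, if $xy\in V$ then $x\in T$ or $y\in T$. Here $V-V=\{v-w : v,w\in V\}$ and $V\cdot V=\{vw : v,w\in V\}$. Then $K$ admits a non-trivial definable valuation, i.e. a non-trivial valuation $v$ whose valuation ring $\mathcal O_v=\{x\in K : v(x)\ge 0\}$ is first-order definable in $K$ in the language of rings, with parameters from $K$. -/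

import Mathlib

universe u

open scoped Pointwise

/-- A field is euclidean if it carries a field ordering in which every non-negative element is a
square. -/
def IsEuclideanField (K : Type*) [Field K] : Prop :=
  ∃ _ : LinearOrder K, IsStrictOrderedRing K ∧ ∀ x : K, 0 ≤ x → IsSquare x

/-- The subgroup `(Kˣ)^q` of `q`-th powers of the multiplicative group of `K`. -/
def powSubgroup (K : Type*) [Field K] (q : ℕ) : Subgroup Kˣ :=
  (powMonoidHom q : Kˣ →* Kˣ).range

/-- The set `T = G + 1 ⊆ K` attached to a multiplicative subgroup `G` of `Kˣ`. -/
def subgroupAddOne {K : Type*} [Field K] (G : Subgroup Kˣ) : Set K :=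
  {x | ∃ g ∈ G, x = (g : K) + 1}

/-- The family `𝓝_G` of all finite intersections `a₁ T ∩ … ∩ aₙ T` with `aᵢ ∈ Kˣ` and
`T = G + 1` (used for subgroups `G` containing `-1`). -/
def zeroNhdFamily {K : Type*} [Field K] (G : Subgroup Kˣ) : Set (Set K) :=
  {U | ∃ (n : ℕ) (a : Fin n → Kˣ), U = ⋂ i, a i • subgroupAddOne G}

/-- A subset of `K` is definable if it is first-order definable, with parameters from `K`, in the
language of rings, `K` carrying its own ring structure. -/
def IsRingDefinable {K : Type*} [Field K] (S : Set K) : Prop :=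
  letI : FirstOrder.Ring.CompatibleRing K := FirstOrder.Ring.compatibleRingOfRing K
  Set.Definable₁ Set.univ FirstOrder.Language.ring S

/-- A valuation on `K` is definable if its valuation ring `{x | v x ≤ 1}` is a definable set. -/
def IsDefinableValuation {K : Type*} [Field K] {Γ : Type*} [LinearOrderedCommGroupWithZero Γ]
    (v : Valuation K Γ) : Prop :=
  IsRingDefinable (v.valuationSubring : Set K)

/-! The four axioms say that the sets `a • T` generate the zero neighbourhoods of a non-discrete
V-topology in which the group of `q`-th powers is open. The task is to turn this topology into a
definable valuation ring.

Put π = q(1 - ζ) and F = `kummerMap`, so that (1 + (1 - ζ)z)^q = 1 + πF(z). Over every valuation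
ring F is integral, with unit leading coefficient and linear coefficient 1. This allows residue
characteristic q to be treated alongside the others. Zorn's lemma gives a minimal valuation ring O,
with maximal ideal 𝔪, such that 1 + π𝔪 consists of `q`-th powers.

The engine is `exists_kummerCompatible_lt`. A ring R between 𝔪 and O, different from O, that is
almost a valuation ring and has 1 + πjR inside the `q`-th powers for some unit j of O, produces a
strictly smaller ring of the same kind, by Chevalley extension and a Hensel argument. Applied to a
ring built from the V-topology (`exists_subring`), it shows that O is non-trivial. Applied to a ring
built from a definable set S with 𝔪 ⊆ S ⊆ O, it shows that O is definable (`definable_of_approx`).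

Such a set S exists if π is a unit and some unit of O is not a `q`-th power, or if π ∈ 𝔪 and 1 + πO
is not contained in the `q`-th powers. If 1 + 𝔪' and all units of some valuation ring are `q`-th
powers, a coarsening of it is definable (`exists_definable_of_units`). In the remaining case a
maximal W with 1 + πW inside the `q`-th powers is sharp (`exists_notMem_of_maximal`), and sharpness
makes W definable (`definable_of_sharp`). -/

/-! ### Closure properties of definable predicates and functions. -/

section Definability

open FirstOrder

variable {K : Type*} [Field K] {α : Type*}

/-- A predicate on tuples which is definable with parameters in the language of rings. -/
def RingDefPred (P : (α → K) → Prop) : Prop :=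
  letI : FirstOrder.Ring.CompatibleRing K := FirstOrder.Ring.compatibleRingOfRing K
  (Set.univ : Set K).Definable FirstOrder.Language.ring {v | P v}

/-- A function on tuples whose graph is definable with parameters in the language of rings. -/
def RingDefFun (f : (α → K) → K) : Prop :=
  letI : FirstOrder.Ring.CompatibleRing K := FirstOrder.Ring.compatibleRingOfRing K
  (Set.univ : Set K).DefinableFun FirstOrder.Language.ring f

theorem isRingDefinable_iff {P : K → Prop} :
    IsRingDefinable {x | P x} ↔ RingDefPred fun v : Fin 1 → K => P (v 0) := Iff.rfl

namespace RingDefPred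

variable {P Q : (α → K) → Prop}

theorem and (hP : RingDefPred P) (hQ : RingDefPred Q) : RingDefPred fun v => P v ∧ Q v :=
  let _ : FirstOrder.Ring.CompatibleRing K := FirstOrder.Ring.compatibleRingOfRing K
  Set.Definable.inter hP hQ

theorem or (hP : RingDefPred P) (hQ : RingDefPred Q) : RingDefPred fun v => P v ∨ Q v :=
  let _ : FirstOrder.Ring.CompatibleRing K := FirstOrder.Ring.compatibleRingOfRing K
  Set.Definable.union hP hQ

theorem not (hP : RingDefPred P) : RingDefPred fun v => ¬ P v :=
  let _ : FirstOrder.Ring.CompatibleRing K := FirstOrder.Ring.compatibleRingOfRing K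
  Set.Definable.compl hP

theorem imp (hP : RingDefPred P) (hQ : RingDefPred Q) : RingDefPred fun v => P v → Q v := by
  simpa only [imp_iff_not_or] using hP.not.or hQ

theorem iff (hP : RingDefPred P) (hQ : RingDefPred Q) : RingDefPred fun v => (P v ↔ Q v) := by
  simpa only [iff_iff_implies_and_implies] using (hP.imp hQ).and (hQ.imp hP)

theorem ex {P : (α → K) → K → Prop}
    (h : RingDefPred fun w : α ⊕ Unit → K => P (fun i => w (Sum.inl i)) (w (Sum.inr ()))) :
    RingDefPred fun v => ∃ x, P v x := by
  let _ : FirstOrder.Ring.CompatibleRing K := FirstOrder.Ring.compatibleRingOfRing K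
  have h' := Set.Definable.exists_of_finite h
  unfold RingDefPred
  convert h' using 1
  ext v
  constructor
  · rintro ⟨x, hx⟩
    exact ⟨fun _ => x, hx⟩
  · rintro ⟨x, hx⟩
    exact ⟨x (), hx⟩

theorem all {P : (α → K) → K → Prop}
    (h : RingDefPred fun w : α ⊕ Unit → K => P (fun i => w (Sum.inl i)) (w (Sum.inr ()))) :
    RingDefPred fun v => ∀ x, P v x := by
  have := (ex (P := fun v x => ¬ P v x) h.not).not
  simpa only [not_exists, not_not] using this

theorem comp [Finite α] {β : Type*} (hP : RingDefPred P) {F : α → (β → K) → K}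
    (hF : ∀ i, RingDefFun (F i)) : RingDefPred fun v => P fun i => F i v :=
  let _ : FirstOrder.Ring.CompatibleRing K := FirstOrder.Ring.compatibleRingOfRing K
  Set.Definable.preimage_map (F := fun v i => F i v) hF hP

theorem eq {f g : (α → K) → K} (hf : RingDefFun f) (hg : RingDefFun g) :
    RingDefPred fun v => f v = g v :=
  let _ : FirstOrder.Ring.CompatibleRing K := FirstOrder.Ring.compatibleRingOfRing K
  Set.DefinableFun.ofPred_eq hf hg

theorem mem {S : Set K} (hS : IsRingDefinable S) {f : (α → K) → K} (hf : RingDefFun f) :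
    RingDefPred fun v => f v ∈ S :=
  comp (P := fun v : Fin 1 → K => v 0 ∈ S) hS (F := fun _ => f) fun _ => hf

end RingDefPred

namespace RingDefFun

variable {f g : (α → K) → K}

theorem proj (i : α) : RingDefFun fun v : α → K => v i :=
  let _ : FirstOrder.Ring.CompatibleRing K := FirstOrder.Ring.compatibleRingOfRing K
  Set.DefinableFun.proj _

theorem const (c : K) : RingDefFun fun _ : α → K => c :=
  let _ : FirstOrder.Ring.CompatibleRing K := FirstOrder.Ring.compatibleRingOfRing K
  FirstOrder.Language.definableFun_const _ _ (Set.mem_univ c)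

theorem add (hf : RingDefFun f) (hg : RingDefFun g) : RingDefFun fun v => f v + g v := by
  let _ : FirstOrder.Ring.CompatibleRing K := FirstOrder.Ring.compatibleRingOfRing K
  have h : (Set.univ : Set K).DefinableFun FirstOrder.Language.ring fun v : Fin 2 → K =>
      ((Language.Term.var 0 + Language.Term.var 1 : Language.ring.Term (Fin 2))).realize v :=
    .of_empty (Language.Term.definableFun_realize _)
  simp only [FirstOrder.Ring.realize_add, Language.Term.realize_var] at h
  exact Set.DefinableFun.comp (g := fun v => ![f v, g v])
    (fun i => by fin_cases i <;> assumption) h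

theorem mul (hf : RingDefFun f) (hg : RingDefFun g) : RingDefFun fun v => f v * g v := by
  let _ : FirstOrder.Ring.CompatibleRing K := FirstOrder.Ring.compatibleRingOfRing K
  have h : (Set.univ : Set K).DefinableFun FirstOrder.Language.ring fun v : Fin 2 → K =>
      ((Language.Term.var 0 * Language.Term.var 1 : Language.ring.Term (Fin 2))).realize v :=
    .of_empty (Language.Term.definableFun_realize _)
  simp only [FirstOrder.Ring.realize_mul, Language.Term.realize_var] at h
  exact Set.DefinableFun.comp (g := fun v => ![f v, g v])
    (fun i => by fin_cases i <;> assumption) h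

theorem neg (hf : RingDefFun f) : RingDefFun fun v => - f v := by
  simpa using (const (-1)).mul hf

theorem sub (hf : RingDefFun f) (hg : RingDefFun g) : RingDefFun fun v => f v - g v := by
  simpa only [sub_eq_add_neg] using hf.add hg.neg

theorem pow (hf : RingDefFun f) (n : ℕ) : RingDefFun fun v => f v ^ n := by
  induction n with
  | zero => simpa using const 1
  | succ n ih => simpa only [pow_succ] using ih.mul hf

theorem inv (hf : RingDefFun f) : RingDefFun fun v => (f v)⁻¹ := by
  -- The convention 0⁻¹ = 0 needs its own disjunct in the graph.
  have h : RingDefPred fun w : Option α → K =>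
      (f (fun i => w (some i)) = 0 ∧ w none = 0) ∨ f (fun i => w (some i)) * w none = 1 := by
    have h1 : RingDefFun fun w : Option α → K => f fun i => w (some i) :=
      letI : FirstOrder.Ring.CompatibleRing K := FirstOrder.Ring.compatibleRingOfRing K
      by
        simpa [RingDefFun, Set.DefinableFun, Function.tupleGraph] using!
          Set.Definable.preimage_comp (fun | none => none | some i => some (some i)) hf
    exact ((RingDefPred.eq h1 (const 0)).and (.eq (proj _) (const 0))).or
      (.eq (h1.mul (proj _)) (const 1))
  unfold RingDefFun Set.DefinableFun
  unfold RingDefPred at h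
  convert h using 1
  ext w
  simp only [Function.tupleGraph, Set.mem_ofPred_eq]
  by_cases h0 : f (fun i => w (some i)) = 0
  · have : f (w ∘ some) = 0 := h0
    simp [this, h0, eq_comm]
  · have h0' : f (w ∘ some) ≠ 0 := h0
    simp only [h0, false_and, false_or]
    exact inv_eq_iff_eq_inv.trans ⟨fun h => by
      rw [show f (fun i => w (some i)) = (w none)⁻¹ from h]
      exact inv_mul_cancel₀ fun h1 => h0' (by rw [h, h1, inv_zero]), fun h => eq_inv_of_mul_eq_one_left h⟩

theorem div (hf : RingDefFun f) (hg : RingDefFun g) : RingDefFun fun v => f v / g v := by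
  simpa only [div_eq_mul_inv] using hf.mul hg.inv

end RingDefFun

end Definability

/-! ### The Kummer polynomial over an arbitrary valuation ring. -/

section Kummer

variable {K : Type*} [Field K] {q : ℕ}

/-- The set of non-zero `q`-th powers of a field. -/
def powSet (K : Type*) [Field K] (q : ℕ) : Set K := {x | x ≠ 0 ∧ ∃ y, y ^ q = x}

namespace powSet

theorem ne_zero {x : K} (hx : x ∈ powSet K q) : x ≠ 0 := hx.1

theorem zero_notMem : (0 : K) ∉ powSet K q := fun h => h.1 rfl

theorem pow_mem {y : K} (hy : y ≠ 0) : y ^ q ∈ powSet K q := ⟨pow_ne_zero _ hy, y, rfl⟩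

theorem one_mem : (1 : K) ∈ powSet K q := ⟨one_ne_zero, 1, one_pow _⟩

theorem mul_mem {x y : K} (hx : x ∈ powSet K q) (hy : y ∈ powSet K q) : x * y ∈ powSet K q := by
  obtain ⟨hx0, a, rfl⟩ := hx
  obtain ⟨hy0, b, rfl⟩ := hy
  exact ⟨mul_ne_zero hx0 hy0, a * b, mul_pow _ _ _⟩

theorem inv_mem {x : K} (hx : x ∈ powSet K q) : x⁻¹ ∈ powSet K q := by
  obtain ⟨hx0, a, rfl⟩ := hx
  exact ⟨inv_ne_zero hx0, a⁻¹, inv_pow _ _⟩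

theorem div_mem {x y : K} (hx : x ∈ powSet K q) (hy : y ∈ powSet K q) : x / y ∈ powSet K q :=
  div_eq_mul_inv x y ▸ mul_mem hx (inv_mem hy)

theorem mul_mem_iff {x y : K} (hx : x ∈ powSet K q) : x * y ∈ powSet K q ↔ y ∈ powSet K q :=
  ⟨fun h => by simpa [hx.1] using mul_mem (inv_mem hx) h, mul_mem hx⟩

theorem mul_mem_iff_right {x y : K} (hx : x ∈ powSet K q) : y * x ∈ powSet K q ↔ y ∈ powSet K q := by
  rw [mul_comm, mul_mem_iff hx]

theorem inv_mem_iff {x : K} : x⁻¹ ∈ powSet K q ↔ x ∈ powSet K q :=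
  ⟨fun h => by simpa using inv_mem h, inv_mem⟩

theorem definable : IsRingDefinable (powSet K q) := by
  refine isRingDefinable_iff.2 (.and (.not (.eq (.proj _) (.const _))) (.ex (.eq ?_ (.proj _))))
  exact .pow (.proj _) _

end powSet

/-- The coefficient `q (1 - ζ)` governing Kummer extensions of degree `q` near `1`. -/
def kummerPi (q : ℕ) (ζ : K) : K := q * (1 - ζ)

/-- The map `z ↦ ((1 + (1 - ζ) z) ^ q - 1) / (q (1 - ζ))`. -/
def kummerMap (q : ℕ) (ζ z : K) : K := ((1 + (1 - ζ) * z) ^ q - 1) / kummerPi q ζ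

/-- The leading coefficient of `kummerMap`. -/
def kummerLead (q : ℕ) (ζ : K) : K := (1 - ζ) ^ (q - 1) / q

/-- The non-leading part of `kummerMap`, divided by the variable. -/
def kummerTail (q : ℕ) (ζ z : K) : K :=
  ∑ i ∈ Finset.range (q - 1), ((q.choose (i + 1) / q : ℕ) : K) * ((1 - ζ) * z) ^ i

variable {ζ : K}

theorem one_sub_ne_zero_of_isPrimitiveRoot (hq : q.Prime) (hζ : IsPrimitiveRoot ζ q) :
    1 - ζ ≠ 0 := by
  rw [sub_ne_zero]
  exact (hζ.ne_one hq.one_lt).symm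

theorem natCast_ne_zero_of_isPrimitiveRoot (hq : q.Prime) (hζ : IsPrimitiveRoot ζ q) :
    (q : K) ≠ 0 := by
  have : NeZero q := ⟨hq.ne_zero⟩
  exact hζ.neZero'.ne

theorem kummerPi_ne_zero (hq : q.Prime) (hζ : IsPrimitiveRoot ζ q) : kummerPi q ζ ≠ 0 :=
  mul_ne_zero (natCast_ne_zero_of_isPrimitiveRoot hq hζ) (one_sub_ne_zero_of_isPrimitiveRoot hq hζ)

theorem one_add_kummerPi_mul_kummerMap (hq : q.Prime) (hζ : IsPrimitiveRoot ζ q) (z : K) :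
    1 + kummerPi q ζ * kummerMap q ζ z = (1 + (1 - ζ) * z) ^ q := by
  rw [kummerMap, mul_div_cancel₀ _ (kummerPi_ne_zero hq hζ)]
  ring

/-- The inner binomial coefficients are divisible by q, so dividing by q(1 - ζ) keeps them integral.
Only the top coefficient could fail to be integral, and `valuation_kummerLead` makes it a unit. -/
theorem kummerMap_eq (hq : q.Prime) (hζ : IsPrimitiveRoot ζ q) (z : K) :
    kummerMap q ζ z = kummerLead q ζ * z ^ q + z * kummerTail q ζ z := by
  have h0 := kummerPi_ne_zero hq hζ
  have hq0 := natCast_ne_zero_of_isPrimitiveRoot hq hζ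
  rw [kummerMap, div_eq_iff h0]
  obtain ⟨n, rfl⟩ : ∃ n, q = n + 1 := ⟨q - 1, (Nat.succ_pred_prime hq).symm⟩
  have hc : ∀ i ∈ Finset.range n, ((n + 1).choose (i + 1) : K) =
      ((n + 1 : ℕ) : K) * (((n + 1).choose (i + 1) / (n + 1) : ℕ) : K) := by
    intro i hi
    rw [← Nat.cast_mul, Nat.mul_div_cancel' (hq.dvd_choose_self i.succ_ne_zero (by simpa using hi))]
  rw [add_comm 1, add_pow, Finset.sum_range_succ, Finset.sum_range_succ']
  simp only [kummerTail, kummerLead, kummerPi, Nat.add_sub_cancel, one_pow, mul_one, Nat.choose_self,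
    Nat.cast_one, pow_zero, Nat.choose_zero_right, add_mul, Finset.mul_sum, Finset.sum_mul]
  rw [Finset.sum_congr rfl fun i hi => by rw [hc i hi]]
  rw [add_right_comm, add_sub_cancel_right, add_comm]
  congr 1
  · rw [mul_pow]
    field_simp
    ring
  · refine Finset.sum_congr rfl fun i _ => ?_
    ring

variable (O : ValuationSubring K)

namespace ValuationSubring

theorem valuation_natCast_le_one (n : ℕ) : O.valuation (n : K) ≤ 1 :=
  (O.valuation_le_one_iff _).2 (natCast_mem O n)

theorem valuation_add_lt_one {x y : K} (hx : O.valuation x < 1) (hy : O.valuation y < 1) :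
    O.valuation (x + y) < 1 := Valuation.map_add_lt _ hx hy

theorem valuation_one_add {x : K} (hx : O.valuation x < 1) : O.valuation (1 + x) = 1 :=
  Valuation.map_one_add_of_lt _ hx

theorem valuation_lt_one_of_inv_notMem {x : K} (hx : x⁻¹ ∉ O) : O.valuation x < 1 := by
  rw [← valuation_le_one_iff, not_le, map_inv₀] at hx
  by_contra! h
  exact absurd hx (not_lt.2 (inv_le_one_of_one_le₀ h))

theorem valuation_inv_lt_one_of_notMem {x : K} (hx : x ∉ O) : O.valuation x⁻¹ < 1 :=
  O.valuation_lt_one_of_inv_notMem (by rwa [inv_inv])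

end ValuationSubring

/-- q is the product of the 1 - ζ^k for 0 < k < q. These all have the same value, because ζ and ζ^k
are powers of each other. -/
theorem valuation_natCast_eq (hq : q.Prime) (hζ : IsPrimitiveRoot ζ q) :
    O.valuation (q : K) = O.valuation (1 - ζ) ^ (q - 1) := by
  obtain ⟨n, rfl⟩ : ∃ n, q = n + 1 := ⟨q - 1, (Nat.succ_pred_prime hq).symm⟩
  have hζO : ∀ k, O.valuation (∑ i ∈ Finset.range k, ζ ^ i) ≤ 1 := by
    intro k
    refine Valuation.map_sum_le _ fun i _ => ?_
    have : O.valuation ζ = 1 := by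
      refine (pow_eq_one_iff.1 ?_).resolve_right n.succ_ne_zero
      rw [← map_pow, hζ.pow_eq_one, map_one]
    rw [map_pow, this, one_pow]
  have h1 : ∀ η : K, η ^ (n + 1) = 1 → ∀ k, O.valuation (1 - η ^ k) ≤ O.valuation (1 - η) := by
    intro η hη k
    rw [← mul_neg_geom_sum, map_mul]
    refine mul_le_of_le_one_right' (Valuation.map_sum_le _ fun i _ => ?_)
    have : O.valuation η = 1 := by
      refine (pow_eq_one_iff.1 ?_).resolve_right n.succ_ne_zero
      rw [← map_pow, hη, map_one]
    rw [map_pow, this, one_pow]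
  have h2 : ∀ k ∈ Finset.range n, O.valuation (1 - ζ ^ (k + 1)) = O.valuation (1 - ζ) := by
    intro k hk
    refine le_antisymm (h1 ζ hζ.pow_eq_one _) ?_
    have hcop : (k + 1).Coprime (n + 1) := by
      refine (Nat.Coprime.symm ((Nat.Prime.coprime_iff_not_dvd hq).2 fun hd => ?_))
      have := Nat.le_of_dvd k.succ_pos hd
      have := Finset.mem_range.1 hk
      omega
    have hprim := hζ.pow_of_coprime _ hcop
    obtain ⟨i, -, hi⟩ := hprim.eq_pow_of_pow_eq_one hζ.pow_eq_one
    conv_lhs => rw [← hi]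
    exact h1 _ hprim.pow_eq_one i
  have := hζ.prod_one_sub_pow_eq_order
  rw [Nat.add_sub_cancel, Nat.cast_add, Nat.cast_one, ← this, map_prod, Finset.prod_congr rfl h2]
  simp

theorem valuation_kummerLead (hq : q.Prime) (hζ : IsPrimitiveRoot ζ q) :
    O.valuation (kummerLead q ζ) = 1 := by
  rw [kummerLead, map_div₀, map_pow, ← valuation_natCast_eq O hq hζ]
  exact div_self ((Valuation.ne_zero_iff _).2 (natCast_ne_zero_of_isPrimitiveRoot hq hζ))

theorem kummerLead_ne_zero (hq : q.Prime) (hζ : IsPrimitiveRoot ζ q) : kummerLead q ζ ≠ 0 :=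
  div_ne_zero (pow_ne_zero _ (one_sub_ne_zero_of_isPrimitiveRoot hq hζ))
    (natCast_ne_zero_of_isPrimitiveRoot hq hζ)

theorem valuation_kummerPi (hq : q.Prime) (hζ : IsPrimitiveRoot ζ q) :
    O.valuation (kummerPi q ζ) = O.valuation (1 - ζ) ^ q := by
  rw [kummerPi, map_mul, valuation_natCast_eq O hq hζ, ← pow_succ, Nat.sub_add_cancel hq.one_le]

theorem valuation_one_sub_le (hq : q.Prime) (hζ : IsPrimitiveRoot ζ q) :
    O.valuation (1 - ζ) ≤ 1 := by
  by_contra! h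
  have h1 := O.valuation_natCast_le_one q
  rw [valuation_natCast_eq O hq hζ] at h1
  exact absurd h1 (not_le.2 (one_lt_pow₀ h (Nat.sub_ne_zero_of_lt hq.one_lt)))

theorem valuation_kummerPi_le (hq : q.Prime) (hζ : IsPrimitiveRoot ζ q) :
    O.valuation (kummerPi q ζ) ≤ 1 := by
  rw [valuation_kummerPi O hq hζ]
  exact pow_le_one₀ zero_le (valuation_one_sub_le O hq hζ)

theorem valuation_kummerTail_le {z : K} (hz : O.valuation ((1 - ζ) * z) ≤ 1) :
    O.valuation (kummerTail q ζ z) ≤ 1 := by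
  refine Valuation.map_sum_le _ fun i _ => ?_
  rw [map_mul, map_pow]
  exact mul_le_one' (O.valuation_natCast_le_one _) (pow_le_one₀ zero_le hz)

theorem valuation_kummerMap_le (hq : q.Prime) (hζ : IsPrimitiveRoot ζ q) {z : K}
    (hz : O.valuation z ≤ 1) : O.valuation (kummerMap q ζ z) ≤ O.valuation z := by
  rw [kummerMap_eq hq hζ]
  refine Valuation.map_add_le _ ?_ ?_
  · rw [map_mul, valuation_kummerLead O hq hζ, one_mul, map_pow]
    exact pow_le_of_le_one zero_le hz hq.ne_zero
  · rw [map_mul]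
    refine mul_le_of_le_one_right' (valuation_kummerTail_le O ?_)
    rw [map_mul]
    exact mul_le_one' (valuation_one_sub_le O hq hζ) hz

/-- The tail has degree q - 2, so the leading term strictly dominates. -/
theorem valuation_kummerMap_of_one_lt (hq : q.Prime) (hζ : IsPrimitiveRoot ζ q) {z : K}
    (hz : 1 < O.valuation z) : O.valuation (kummerMap q ζ z) = O.valuation z ^ q := by
  have h1 : O.valuation (kummerLead q ζ * z ^ q) = O.valuation z ^ q := by
    rw [map_mul, valuation_kummerLead O hq hζ, one_mul, map_pow]
  rw [kummerMap_eq hq hζ, ← h1]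
  refine Valuation.map_add_eq_of_lt_left _ ?_
  rw [h1, map_mul]
  have h2 : O.valuation (kummerTail q ζ z) ≤ O.valuation z ^ (q - 2) := by
    refine Valuation.map_sum_le _ fun i hi => ?_
    have hi := Finset.mem_range.1 hi
    rw [map_mul, map_pow, map_mul]
    refine mul_le_of_le_one_of_le (O.valuation_natCast_le_one _) ?_
    refine le_trans (pow_le_pow_left₀ zero_le (mul_le_of_le_one_left' (valuation_one_sub_le O hq hζ)) i) ?_
    exact pow_le_pow_right₀ hz.le (by omega)
  calc _ ≤ O.valuation z * O.valuation z ^ (q - 2) := mul_le_mul_right h2 _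
    _ = O.valuation z ^ (q - 1) := by
      rw [← pow_succ']
      congr 1
      have := hq.two_le
      omega
    _ < _ := pow_lt_pow_right₀ hz (by have := hq.two_le; omega)

end Kummer

/-! ### Additive stabilizers and their multiplier rings. -/

section Stabilizers

variable {K : Type*} [Field K]

/-- The additive stabilizer of a set. -/
def addStab (S : Set K) : AddSubgroup K where
  carrier := {x | ∀ y, x + y ∈ S ↔ y ∈ S}
  zero_mem' y := by rw [zero_add]
  add_mem' {a b} ha hb y := by rw [add_assoc, ha, hb]
  neg_mem' {a} ha y := by rw [← ha, add_neg_cancel_left]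

/-- The ring of multipliers of the additive stabilizer of a set. -/
def stabSubring (S : Set K) : Subring K where
  carrier := {x | ∀ y ∈ addStab S, x * y ∈ addStab S}
  mul_mem' {a b} ha hb y hy := by rw [mul_assoc]; exact ha _ (hb _ hy)
  one_mem' y hy := by rwa [one_mul]
  add_mem' {a b} ha hb y hy := by rw [add_mul]; exact add_mem (ha _ hy) (hb _ hy)
  zero_mem' y _ := by rw [zero_mul]; exact zero_mem _
  neg_mem' {a} ha y hy := by rw [neg_mul]; exact neg_mem (ha _ hy)

variable {S : Set K}

theorem addStab_subset (h0 : (0 : K) ∈ S) {x : K} (hx : x ∈ addStab S) : x ∈ S := by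
  simpa [h0] using hx 0

theorem mem_addStab_of_add_mem {x : K} (h1 : ∀ y ∈ S, x + y ∈ S) (h2 : ∀ y ∈ S, -x + y ∈ S) :
    x ∈ addStab S :=
  fun y => ⟨fun h => by simpa using h2 _ h, h1 y⟩

theorem IsRingDefinable.addStab (hS : IsRingDefinable S) :
    IsRingDefinable (addStab S : Set K) := by
  refine (isRingDefinable_iff (P := fun x => ∀ y, x + y ∈ S ↔ y ∈ S)).2 (.all (.iff ?_ ?_))
  · exact .mem hS (.add (.proj _) (.proj _))
  · exact .mem hS (.proj _)

theorem IsRingDefinable.stabSubring (hS : IsRingDefinable S) :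
    IsRingDefinable (stabSubring S : Set K) := by
  refine (isRingDefinable_iff (P := fun x => ∀ y, y ∈ _root_.addStab S →
    x * y ∈ _root_.addStab S)).2 (.all (.imp ?_ ?_))
  · exact .mem hS.addStab (.proj _)
  · exact .mem hS.addStab (.mul (.proj _) (.proj _))

end Stabilizers

/-! ### V-topologies, and an almost valuation ring obtained from one. -/

section VFilter

open Filter

variable {K : Type*} [Field K]

/-- A family of functions is uniformly bounded with respect to a filter of neighbourhoods of zero
if multiplication by small elements makes all values uniformly small. -/
def Filter.BddFun (F : Filter K) {ι : Type*} (f : ι → K) : Prop :=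
  Tendsto (fun p : K × ι => p.1 * f p.2) (F ×ˢ ⊤) F

/-- The filter of neighbourhoods of zero of a non-discrete V-topology. -/
structure Filter.IsVFilter (F : Filter K) : Prop where
  zero : pure 0 ≤ F
  exists_ne_zero : ∀ U ∈ F, ∃ x ∈ U, x ≠ 0
  smul : ∀ a : K, Tendsto (fun x => x * a) F F
  sub : Tendsto (fun p : K × K => p.1 - p.2) (F ×ˢ F) F
  mul : Tendsto (fun p : K × K => p.1 * p.2) (F ×ˢ F) F
  inv : ∀ U ∈ F, F.BddFun (Subtype.val : {x : K | x = 0 ∨ x⁻¹ ∉ U} → K)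

namespace Filter.IsVFilter

variable {F : Filter K} (hF : F.IsVFilter) {ι κ : Type*}
include hF

theorem neg : Tendsto (fun x => -x) F F := by simpa using hF.smul (-1)

theorem add : Tendsto (fun p : K × K => p.1 + p.2) (F ×ˢ F) F := by
  simpa [Function.comp_def] using hF.sub.comp (tendsto_fst.prodMk (hF.neg.comp tendsto_snd))

omit hF in
theorem bdd_mul {f g : ι → K} (hf : F.BddFun f) (hg : F.BddFun g) :
    F.BddFun fun i => f i * g i := by
  simpa [BddFun, mul_assoc, Function.comp_def] using Tendsto.comp hg (hf.prodMk tendsto_snd)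

theorem bdd_const (c : K) : F.BddFun fun _ : ι => c := (hF.smul c).comp tendsto_fst

theorem bdd_pow {f : ι → K} (hf : F.BddFun f) (n : ℕ) : F.BddFun fun i => f i ^ n := by
  induction n with
  | zero => simpa using hF.bdd_const 1
  | succ n ih => simpa only [pow_succ] using bdd_mul ih hf

omit hF in
theorem bdd_comp {f : ι → K} (hf : F.BddFun f) (e : κ → ι) : F.BddFun fun i => f (e i) :=
  Tendsto.comp hf (tendsto_fst.prodMk (tendsto_top (f := fun p : K × κ => e p.2)))

theorem bdd_of_inv_notMem {f : ι → K} {U : Set K} (hU : U ∈ F)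
    (hf : ∀ i, f i = 0 ∨ (f i)⁻¹ ∉ U) : F.BddFun f :=
  bdd_comp (hF.inv U hU) fun i => ⟨f i, hf i⟩

omit hF [Field K] in
theorem eventually_forall {p : K → ι → Prop} (h : ∀ᶠ x in F ×ˢ (⊤ : Filter ι), p x.1 x.2) :
    ∀ᶠ c in F, ∀ i, p c i := by
  rw [← principal_univ, eventually_prod_principal_iff] at h
  simpa using h

omit hF in
theorem bdd_eventually {f : ι → K} (hf : F.BddFun f) {U : Set K} (hU : U ∈ F) :
    ∀ᶠ c in F, ∀ i, c * f i ∈ U :=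
  eventually_forall (hf.eventually hU)

theorem tendsto_pow {n : ℕ} (hn : n ≠ 0) : Tendsto (fun x => x ^ n) F F := by
  induction n with
  | zero => exact absurd rfl hn
  | succ n ih =>
    rcases eq_or_ne n 0 with rfl | h
    · simp only [zero_add, pow_one]
      exact tendsto_id
    · simpa [pow_succ, Function.comp_def] using hF.mul.comp ((ih h).prodMk tendsto_id)

/-- Powers are uniformly continuous on bounded sets: with Δₙ = (f + w)^n - f^n, one has Δₙ₊₁ = Δₙf +
Δₙw + wf^n. -/
theorem tendsto_add_pow_sub {f : ι → K} (hf : F.BddFun f) (n : ℕ) :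
    Tendsto (fun p : K × ι => (f p.2 + p.1) ^ n - f p.2 ^ n) (F ×ˢ ⊤) F := by
  induction n with
  | zero =>
    simp only [pow_zero, sub_self]
    exact (tendsto_pure.2 (Eventually.of_forall fun _ => rfl)).mono_right hF.zero
  | succ n ih =>
    have h1 : Tendsto (fun p : K × ι => ((f p.2 + p.1) ^ n - f p.2 ^ n) * f p.2) (F ×ˢ ⊤) F :=
      Tendsto.comp hf (ih.prodMk tendsto_snd)
    have h2 : Tendsto (fun p : K × ι => ((f p.2 + p.1) ^ n - f p.2 ^ n) * p.1) (F ×ˢ ⊤) F :=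
      hF.mul.comp (ih.prodMk tendsto_fst)
    have h3 := Tendsto.comp hF.add ((Tendsto.comp hF.add (h1.prodMk h2)).prodMk (hF.bdd_pow hf n))
    refine h3.congr fun p => ?_
    simp only [Function.comp_apply]
    ring

/-- A set which is bounded and uniformly open has an almost valuation ring as `stabSubring`. -/
theorem exists_dvd_of_bdd {S T : Set K} (h0 : (0 : K) ∈ S) (hT : T ∈ F) (h1 : (1 : K) ∉ T)
    (hS : F.BddFun (Subtype.val : S → K)) (hadd : ∀ᶠ w in F, ∀ x ∈ S, w + x ∈ S) :
    (∃ d : K, d ≠ 0 ∧ ∀ x, x ≠ 0 → x ∈ stabSubring S ∨ d / x ∈ stabSubring S) ∧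
      ∃ j : K, j ≠ 0 ∧ ∀ x ∈ stabSubring S, j * x ∈ T := by
  have hA : ∀ᶠ w in F, w ∈ addStab S := by
    filter_upwards [hadd, hF.neg.eventually hadd] with w hw hw'
    exact mem_addStab_of_add_mem hw hw'
  have hAb : F.BddFun (Subtype.val : addStab S → K) :=
    bdd_comp hS fun i : addStab S => ⟨i.1, addStab_subset h0 i.2⟩
  -- The stabilizer is open and bounded, so small scalars map it into itself.
  have hR : ∀ᶠ c in F, c ∈ stabSubring S := by
    filter_upwards [bdd_eventually hAb hA] with c hc y hy using hc ⟨y, hy⟩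
  constructor
  -- Inverses of elements outside the open multiplier ring are bounded, hence so are products of two
  -- of them. Choose d moving all these products into T. If x and d/x were both outside, then d ·
  -- x⁻¹ · (d/x)⁻¹ = 1 would lie in T.
  · have hB := hF.inv _ hR
    have hBB := bdd_mul (bdd_comp hB Prod.fst) (bdd_comp hB Prod.snd)
    obtain ⟨d, hd, hd0⟩ := hF.exists_ne_zero _ (bdd_eventually hBB hT)
    refine ⟨d, hd0, fun x hx => ?_⟩
    by_contra! hcon
    refine h1 ?_
    have := hd (⟨x⁻¹, Or.inr (by rw [inv_inv]; exact hcon.1)⟩,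
      ⟨(d / x)⁻¹, Or.inr (by rw [inv_inv]; exact hcon.2)⟩)
    convert this using 1
    simp only
    field_simp
  · obtain ⟨w, hw, hw0⟩ := hF.exists_ne_zero _ hA
    obtain ⟨c, hc, hc0⟩ := hF.exists_ne_zero _ (bdd_eventually hAb hT)
    refine ⟨c * w, mul_ne_zero hc0 hw0, fun x hx => ?_⟩
    rw [mul_assoc, mul_comm w]
    exact hc ⟨x * w, hx w hw⟩

/-- If the group of `q`-th powers is open and proper in a V-topology, then the multiplier ring of
`{x | a - x ^ q ∈ a (Kˣ)^q}` is an almost valuation ring. -/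
theorem exists_subring {q : ℕ} (hq : q ≠ 0) (hneg : (-1 : K) ∈ powSet K q)
    (hT : ∀ᶠ x in F, 1 + x ∈ powSet K q) {a : K} (ha0 : a ≠ 0) (ha : a ∉ powSet K q) :
    ∃ R : Subring K, (∃ d : K, d ≠ 0 ∧ ∀ x, x ≠ 0 → x ∈ R ∨ d / x ∈ R) ∧
      ∃ j : K, j ≠ 0 ∧ ∀ x ∈ R, 1 + j * x ∈ powSet K q := by
  have hT' : ∀ᶠ x in F, 1 - x ∈ powSet K q := by
    simpa [sub_eq_add_neg] using hF.neg.eventually hT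
  set S : Set K := {x | (a - x ^ q) / a ∈ powSet K q} with hSdef
  have h0 : (0 : K) ∈ S := by
    simpa [hSdef, hq, ha0] using powSet.one_mem
  -- If x⁻¹ is small, then a - x^q = -x^q(1 - a/x^q) is a `q`-th power; dividing it by (a - x^q)/a
  -- would make a one as well.
  have hS : F.BddFun (Subtype.val : S → K) := by
    refine hF.bdd_of_inv_notMem (((hF.smul a).comp (hF.tendsto_pow hq)).eventually hT') ?_
    rintro ⟨x, hx⟩
    refine or_iff_not_imp_left.2 fun hx0 hmem => ha ?_
    simp only at hx0
    have h1 : 1 - x⁻¹ ^ q * a ∈ powSet K q := hmem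
    have h2 : a - x ^ q ∈ powSet K q := by
      have := powSet.mul_mem (powSet.mul_mem hneg (powSet.pow_mem (q := q) hx0)) h1
      convert this using 1
      rw [inv_pow]
      field_simp
      ring
    have h3 := powSet.div_mem h2 hx
    rwa [div_div_cancel₀ h2.1] at h3
  have hadd : ∀ᶠ w in F, ∀ x ∈ S, w + x ∈ S := by
    -- a - x^q stays away from 0, since otherwise x^q/a = 1 - (a - x^q)/a would be a `q`-th power.
    -- Hence (a - (x + w)^q)/(a - x^q) is uniformly close to 1 for small w.
    have hE : F.BddFun fun i : S => (a - (i : K) ^ q)⁻¹ := by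
      refine hF.bdd_of_inv_notMem ((hF.smul a⁻¹).eventually hT') fun i => ?_
      right
      intro hmem
      have h1 : 1 - (a - (i : K) ^ q)⁻¹⁻¹ * a⁻¹ ∈ powSet K q := hmem
      rw [inv_inv] at h1
      have h2 : 1 - (a - (i : K) ^ q) * a⁻¹ = (i : K) ^ q / a := by
        field_simp
        ring
      rw [h2] at h1
      have hi : (i : K) ≠ 0 := by
        intro h
        rw [h, zero_pow hq, zero_div] at h1
        exact h1.1 rfl
      have h3 := powSet.div_mem (powSet.pow_mem (q := q) hi) h1
      rw [div_div_cancel₀ (pow_ne_zero _ hi)] at h3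
      exact ha h3
    have h1 := Tendsto.comp hE ((hF.tendsto_add_pow_sub hS q).prodMk tendsto_snd)
    have h2 := eventually_forall (p := fun (w : K) (i : S) =>
      1 - (((i : K) + w) ^ q - (i : K) ^ q) * (a - (i : K) ^ q)⁻¹ ∈ powSet K q) (h1.eventually hT')
    filter_upwards [h2] with w hw x hx
    have h3 := powSet.mul_mem hx (hw ⟨x, hx⟩)
    have h4 : a - x ^ q ≠ 0 := fun h => hx.1 (by rw [h, zero_div])
    change (a - (w + x) ^ q) / a ∈ powSet K q
    convert h3 using 1
    simp only
    field_simp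
    ring
  obtain ⟨hd, j, hj0, hj⟩ := hF.exists_dvd_of_bdd (T := {x | 1 - x ∈ powSet K q}) h0 hT'
    (by simp [powSet]) hS hadd
  refine ⟨stabSubring S, hd, -j, neg_ne_zero.2 hj0, fun x hx => ?_⟩
  rw [neg_mul, ← sub_eq_add_neg]
  exact hj x hx

end Filter.IsVFilter

end VFilter

/-! ### From the axioms on T to a V-topology. -/

section ZeroNhdFamily

open Filter

variable {K : Type*} [Field K] {G : Subgroup Kˣ}

/-- The filter generated by the sets `a • (G + 1)`. -/
def zeroNhdFilter (G : Subgroup Kˣ) : Filter K := ⨅ a : Kˣ, 𝓟 (a • subgroupAddOne G)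

theorem smul_mem_zeroNhdFilter (a : Kˣ) : a • subgroupAddOne G ∈ zeroNhdFilter G :=
  mem_iInf_of_mem a (mem_principal_self _)

theorem mem_zeroNhdFilter_of_mem {U : Set K} (hU : U ∈ zeroNhdFamily G) : U ∈ zeroNhdFilter G := by
  obtain ⟨n, a, rfl⟩ := hU
  exact iInter_mem.2 fun i => smul_mem_zeroNhdFilter _

theorem exists_finite_of_mem_zeroNhdFilter {U : Set K} (hU : U ∈ zeroNhdFilter G) :
    ∃ t : Set Kˣ, t.Finite ∧ (⋂ a ∈ t, a • subgroupAddOne G) ⊆ U :=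
  (hasBasis_iInf_principal_finite fun a : Kˣ => a • subgroupAddOne G).mem_iff.1 hU

theorem biInter_mem_zeroNhdFamily {t : Set Kˣ} (ht : t.Finite) :
    (⋂ a ∈ t, a • subgroupAddOne G) ∈ zeroNhdFamily G := by
  refine ⟨ht.toFinset.card, fun i => ht.toFinset.equivFin.symm i, ?_⟩
  ext x
  simp only [Set.mem_iInter]
  constructor
  · intro h i
    exact h _ (ht.mem_toFinset.1 (ht.toFinset.equivFin.symm i).2)
  · intro h a ha
    simpa using h (ht.toFinset.equivFin ⟨a, ht.mem_toFinset.2 ha⟩)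

theorem mem_smul_subgroupAddOne_iff {a : Kˣ} {x : K} :
    x ∈ a • subgroupAddOne G ↔ (a : K)⁻¹ * x ∈ subgroupAddOne G := by
  rw [Set.mem_smul_set_iff_inv_smul_mem, Units.smul_def, Units.val_inv_eq_inv_val, smul_eq_mul]

/-- The generating family is invariant under scaling, so each condition need only be checked at T,
where it is one of the four axioms: `V1` gives non-discreteness, `V3` and `V4` continuity, `V6` the
V-property. -/
theorem isVFilter_zeroNhdFilter (hneg : -1 ∈ G) (V1 : ({0} : Set K) ∉ zeroNhdFamily G)
    (V3 : ∃ V ∈ zeroNhdFamily G, V - V ⊆ subgroupAddOne G)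
    (V4 : ∃ V ∈ zeroNhdFamily G, V * V ⊆ subgroupAddOne G)
    (V6 : ∃ V ∈ zeroNhdFamily G, ∀ x y : K, x * y ∈ V →
      x ∈ subgroupAddOne G ∨ y ∈ subgroupAddOne G) :
    (zeroNhdFilter G).IsVFilter := by
  have hT0 : (0 : K) ∈ subgroupAddOne G := ⟨-1, hneg, by simp⟩
  have haT0 : ∀ a : Kˣ, (0 : K) ∈ a • subgroupAddOne G := fun a => by
    rwa [mem_smul_subgroupAddOne_iff, mul_zero]
  have hzero : pure 0 ≤ zeroNhdFilter G := le_iInf fun a => by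
    simpa using haT0 a
  have hsmul : ∀ a : K, Tendsto (fun x => x * a) (zeroNhdFilter G) (zeroNhdFilter G) := by
    intro a
    rcases eq_or_ne a 0 with rfl | ha
    · simp only [mul_zero]
      exact (tendsto_pure.2 (Eventually.of_forall fun _ => rfl)).mono_right hzero
    · refine tendsto_iInf.2 fun b => tendsto_principal.2 ?_
      filter_upwards [smul_mem_zeroNhdFilter (G := G) (b / Units.mk0 a ha)] with x hx
      rw [mem_smul_subgroupAddOne_iff] at hx ⊢
      convert hx using 1
      simp
      ring
  refine ⟨hzero, ?_, hsmul, ?_, ?_, ?_⟩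
  · intro U hU
    obtain ⟨t, ht, htU⟩ := exists_finite_of_mem_zeroNhdFilter hU
    by_contra! hcon
    refine V1 ?_
    convert biInter_mem_zeroNhdFamily (G := G) ht using 1
    ext x
    refine ⟨?_, fun hx => hcon x (htU hx)⟩
    rintro rfl
    simpa using fun a _ => haT0 a
  · obtain ⟨V, hV, hVT⟩ := V3
    refine tendsto_iInf.2 fun b => tendsto_principal.2 ?_
    have h := (hsmul (b : K)⁻¹).eventually (mem_zeroNhdFilter_of_mem hV)
    filter_upwards [h.prod_mk h] with p hp
    rw [mem_smul_subgroupAddOne_iff]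
    convert hVT (Set.sub_mem_sub hp.1 hp.2) using 1
    ring
  · obtain ⟨V, hV, hVT⟩ := V4
    refine tendsto_iInf.2 fun b => tendsto_principal.2 ?_
    have h := (hsmul (b : K)⁻¹).eventually (mem_zeroNhdFilter_of_mem hV)
    filter_upwards [h.prod_mk (mem_zeroNhdFilter_of_mem hV)] with p hp
    rw [mem_smul_subgroupAddOne_iff]
    convert hVT (Set.mul_mem_mul hp.1 hp.2) using 1
    ring
  · obtain ⟨V, hV, hVT⟩ := V6
    intro U hU
    obtain ⟨t, ht, htU⟩ := exists_finite_of_mem_zeroNhdFilter hU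
    refine tendsto_iInf.2 fun b => tendsto_principal.2 ?_
    rw [← principal_univ, eventually_prod_principal_iff]
    -- If x⁻¹ ∉ U, some a ∈ t has a⁻¹x⁻¹ ∉ T. As (a⁻¹x⁻¹)(b⁻¹cx) = c a⁻¹b⁻¹ ∈ V, the axiom forces
    -- b⁻¹cx ∈ T.
    have h : ∀ᶠ c in zeroNhdFilter G, ∀ a ∈ t, c * ((a : K)⁻¹ * (b : K)⁻¹) ∈ V :=
      (eventually_all_finite ht).2 fun a _ =>
        (hsmul _).eventually (mem_zeroNhdFilter_of_mem hV)
    filter_upwards [h] with c hc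
    rintro ⟨x, hx⟩ -
    rcases eq_or_ne x 0 with rfl | hx0
    · simpa using haT0 b
    replace hx := hx.resolve_left hx0
    obtain ⟨a, ha, hxa⟩ : ∃ a ∈ t, x⁻¹ ∉ a • subgroupAddOne G := by
      by_contra! hcon
      exact hx (htU (by simpa using hcon))
    rw [mem_smul_subgroupAddOne_iff] at hxa ⊢
    refine (hVT ((a : K)⁻¹ * x⁻¹) _ ?_).resolve_left hxa
    convert hc a ha using 1
    simp only
    field_simp

theorem mem_powSubgroup_iff {q : ℕ} (hq : q ≠ 0) {g : Kˣ} :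
    g ∈ powSubgroup K q ↔ (g : K) ∈ powSet K q := by
  constructor
  · rintro ⟨y, rfl⟩
    exact powSet.pow_mem y.ne_zero
  · rintro ⟨-, y, hy⟩
    have hy0 : y ≠ 0 := by
      rintro rfl
      rw [zero_pow hq] at hy
      exact g.ne_zero hy.symm
    exact ⟨Units.mk0 y hy0, Units.ext hy⟩

theorem mem_subgroupAddOne_powSubgroup_iff {q : ℕ} (hq : q ≠ 0) {x : K} :
    x ∈ subgroupAddOne (powSubgroup K q) ↔ x - 1 ∈ powSet K q := by
  constructor
  · rintro ⟨g, hg, rfl⟩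
    rw [add_sub_cancel_right]
    exact (mem_powSubgroup_iff hq).1 hg
  · intro h
    exact ⟨Units.mk0 _ h.1, (mem_powSubgroup_iff hq).2 h, by simp⟩

end ZeroNhdFamily

/-! ### Kummer compatible valuation rings and their refinement. -/

section KummerCompatible

variable {K : Type*} [Field K] {q : ℕ} {ζ : K}

/-- A valuation ring is `q`-Kummer compatible if all elements `1 + q (1 - ζ) m`, with `m` in the
maximal ideal, are `q`-th powers. -/
def KummerCompatible (q : ℕ) (ζ : K) (O : ValuationSubring K) : Prop :=
  ∀ m, O.valuation m < 1 → 1 + kummerPi q ζ * m ∈ powSet K q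

-- Modulo p^(N+1) the polynomial F - p has nilpotent value -p and derivative 1 at 0, so Newton's
-- method finds a root there. The ring O itself need not be henselian.
open Polynomial in
theorem exists_kummerMap_sub_mem (hq : q.Prime) (hζ : IsPrimitiveRoot ζ q) (O : ValuationSubring K)
    {p : K} (hp : O.valuation p < 1) (N : ℕ) :
    ∃ y t : K, O.valuation y < 1 ∧ t ∈ O ∧ kummerMap q ζ y = p + p ^ (N + 1) * t := by
  have hO : ∀ {x : K}, O.valuation x ≤ 1 → x ∈ O := fun h => (O.valuation_le_one_iff _).1 h
  let p' : O := ⟨p, hO hp.le⟩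
  let u : O := ⟨kummerLead q ζ, hO (valuation_kummerLead O hq hζ).le⟩
  let l : O := ⟨1 - ζ, hO (valuation_one_sub_le O hq hζ)⟩
  let tail : O[X] := ∑ i ∈ Finset.range (q - 1), C ((q.choose (i + 1) / q : ℕ) : O) * (C l * X) ^ i
  let f : O[X] := C u * X ^ q + X * tail - C p'
  let I : Ideal O := Ideal.span {p' ^ (N + 1)}
  have hnil : IsNilpotent (Ideal.Quotient.mk I p') :=
    ⟨N + 1, by rw [← map_pow, Ideal.Quotient.eq_zero_iff_mem]; exact Ideal.mem_span_singleton_self _⟩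
  have hf0 : f.eval 0 = - p' := by simp [f, zero_pow hq.ne_zero]
  have htail : tail.eval 0 = 1 := by
    obtain ⟨n, hn⟩ : ∃ n, q - 1 = n + 1 := ⟨q - 2, by have := hq.two_le; omega⟩
    simp only [tail, hn, Finset.sum_range_succ', eval_add]
    rw [eval_finsetSum, Finset.sum_eq_zero fun i _ => by simp [zero_pow i.succ_ne_zero]]
    simp [Nat.div_self hq.pos]
  have hf1 : f.derivative.eval 0 = 1 := by
    simp [f, htail, derivative_X_pow, zero_pow (Nat.sub_ne_zero_of_lt hq.one_lt)]
  have ha : ∀ g : O[X], aeval (0 : O ⧸ I) g = Ideal.Quotient.mk I (g.eval 0) := by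
    intro g
    have := aeval_algebraMap_apply (O ⧸ I) (0 : O) g
    rwa [map_zero, coe_aeval_eq_eval] at this
  obtain ⟨r, ⟨hr1, hr2⟩, -⟩ := existsUnique_nilpotent_sub_and_aeval_eq_zero (S := O ⧸ I) (P := f) (x := 0)
    (by rw [ha, hf0, map_neg]; exact hnil.neg) (by rw [ha, hf1, map_one]; exact isUnit_one)
  obtain ⟨y, rfl⟩ := Ideal.Quotient.mk_surjective r
  have h1 : f.eval y ∈ I := by
    rw [← Ideal.Quotient.eq_zero_iff_mem, ← hr2]
    exact ((aeval_algebraMap_apply (O ⧸ I) y f).trans (by rw [coe_aeval_eq_eval]; rfl)).symm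
  obtain ⟨t, ht⟩ := Ideal.mem_span_singleton.1 h1
  have hy : O.valuation (y : K) < 1 := by
    rw [zero_sub, isNilpotent_neg_iff] at hr1
    obtain ⟨n, hn⟩ := hr1
    rw [← map_pow, Ideal.Quotient.eq_zero_iff_mem] at hn
    obtain ⟨s, hs⟩ := Ideal.mem_span_singleton.1 hn
    have h2 : O.valuation ((y : K) ^ n) < 1 := by
      have : (y : K) ^ n = p ^ (N + 1) * s := congrArg Subtype.val hs
      rw [this, map_mul, map_pow]
      exact mul_lt_one_of_lt_of_le (pow_lt_one₀ zero_le hp N.succ_ne_zero) (O.valuation_le_one s)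
    by_contra! h
    rw [map_pow] at h2
    exact absurd h2 (not_lt.2 (one_le_pow₀ h))
  refine ⟨y, t, hy, t.2, ?_⟩
  have h3 : ((f.eval y : O) : K) = kummerMap q ζ y - p := by
    rw [kummerMap_eq hq hζ]
    simp [f, tail, kummerTail, eval_finsetSum, u, l, p']
  rw [ht] at h3
  have h4 : ((p' ^ (N + 1) * t : O) : K) = p ^ (N + 1) * t := rfl
  rw [← sub_eq_iff_eq_add', ← h3, h4]

/-- A form of Hensel's lemma for Kummer extensions. -/
theorem kummerCompatible_of_eventually (hq : q.Prime) (hζ : IsPrimitiveRoot ζ q)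
    (O : ValuationSubring K) (h : ∀ p, O.valuation p < 1 → ∃ N : ℕ, ∀ t ∈ O,
      1 + kummerPi q ζ * (p ^ N * t) ∈ powSet K q) : KummerCompatible q ζ O := by
  intro p hp
  obtain ⟨N, hN⟩ := h p hp
  obtain ⟨y, t, hy, ht, hyt⟩ := exists_kummerMap_sub_mem hq hζ O hp N
  have h1 := one_add_kummerPi_mul_kummerMap hq hζ y
  have h2 : O.valuation (1 + (1 - ζ) * y) = 1 := by
    refine O.valuation_one_add ?_
    rw [map_mul, mul_comm]
    exact mul_lt_one_of_lt_of_le hy (valuation_one_sub_le O hq hζ)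
  set c := 1 + (1 - ζ) * y
  have hc0 : c ≠ 0 := fun h0 => by simp [h0] at h2
  -- Here c^q = 1 + π(p + p^(N+1)t), so 1 + πp = c^q(1 - πp^N(pt)/c^q), and the hypothesis covers
  -- the second factor.
  have h3 := hN (-(p * t) / c ^ q) (by
    rw [← O.valuation_le_one_iff, map_div₀, Valuation.map_neg, map_pow, h2, one_pow, div_one,
      map_mul]
    exact mul_le_one' hp.le ((O.valuation_le_one_iff _).2 ht))
  have h4 := powSet.mul_mem (powSet.pow_mem (q := q) hc0) h3
  convert h4 using 1
  rw [hyt] at h1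
  rw [mul_add, mul_one, mul_comm (c ^ q), mul_assoc, mul_assoc, div_mul_cancel₀ _ (pow_ne_zero _ hc0),
    ← h1]
  ring

/-- The localization of a valuation ring at the radical of the ideal generated by `k`. -/
def ValuationSubring.localizationRadical (O : ValuationSubring K) {k : K}
    (hk : O.valuation k < 1) : ValuationSubring K :=
  O.ofLE
    { carrier := {x | ∀ n : ℕ, O.valuation k * O.valuation x ^ n < 1}
      one_mem' n := by simpa using hk
      zero_mem' n := by
        refine mul_lt_one_of_lt_of_le hk ?_
        rw [map_zero]
        exact pow_le_one₀ le_rfl zero_le_one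
      neg_mem' {x} hx n := by simpa using hx n
      mul_mem' {x y} hx hy n := by
        rw [map_mul]
        rcases le_total (O.valuation x) (O.valuation y) with h | h
        · refine lt_of_le_of_lt (mul_le_mul_right ?_ _) (hy (2 * n))
          rw [two_mul, pow_add, mul_pow]
          gcongr
        · refine lt_of_le_of_lt (mul_le_mul_right ?_ _) (hx (2 * n))
          rw [two_mul, pow_add, mul_pow]
          gcongr
      add_mem' {x y} hx hy n := by
        rcases Valuation.map_add' O.valuation x y with h | h
        · exact lt_of_le_of_lt (mul_le_mul_right (pow_le_pow_left₀ zero_le h n) _) (hx n)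
        · exact lt_of_le_of_lt (mul_le_mul_right (pow_le_pow_left₀ zero_le h n) _) (hy n) }
    fun x hx n => mul_lt_one_of_lt_of_le hk
      (pow_le_one₀ zero_le ((O.valuation_le_one_iff x).2 hx))

theorem ValuationSubring.mem_localizationRadical {O : ValuationSubring K} {k : K}
    (hk : O.valuation k < 1) {x : K} :
    x ∈ O.localizationRadical hk ↔ ∀ n : ℕ, O.valuation k * O.valuation x ^ n < 1 := Iff.rfl

theorem ValuationSubring.le_localizationRadical {O : ValuationSubring K} {k : K}
    (hk : O.valuation k < 1) : O ≤ O.localizationRadical hk :=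
  fun x hx _ => mul_lt_one_of_lt_of_le hk
      (pow_le_one₀ zero_le ((O.valuation_le_one_iff x).2 hx))

/-- After localizing at the radical of (k), every element of the maximal ideal has a power divisible
by k, which is what `kummerCompatible_of_eventually` needs. -/
theorem exists_kummerCompatible_of_principal (hq : q.Prime) (hζ : IsPrimitiveRoot ζ q)
    (O : ValuationSubring K) {k : K} (hk0 : k ≠ 0) (hk : O.valuation k < 1)
    (h : ∀ x ∈ O, 1 + kummerPi q ζ * (k * x) ∈ powSet K q) :
    ∃ O' : ValuationSubring K, O ≤ O' ∧ k⁻¹ ∉ O' ∧ KummerCompatible q ζ O' := by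
  have hvk : O.valuation k ≠ 0 := (Valuation.ne_zero_iff _).2 hk0
  refine ⟨O.localizationRadical hk, O.le_localizationRadical hk, ?_, ?_⟩
  · intro h1
    simpa [hvk] using O.mem_localizationRadical hk |>.1 h1 1
  · refine kummerCompatible_of_eventually hq hζ _ fun p hp => ?_
    rcases eq_or_ne p 0 with rfl | hp0
    · refine ⟨1, fun t _ => ?_⟩
      simpa using powSet.one_mem
    have hpinv : p⁻¹ ∉ O.localizationRadical hk := by
      rw [← ValuationSubring.valuation_le_one_iff, map_inv₀, not_le]
      exact one_lt_inv_iff₀.2 ⟨zero_lt_iff.2 ((Valuation.ne_zero_iff _).2 hp0), hp⟩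
    obtain ⟨n, hn⟩ : ∃ n : ℕ, O.valuation p ^ n ≤ O.valuation k := by
      rw [O.mem_localizationRadical hk] at hpinv
      push Not at hpinv
      obtain ⟨n, hn⟩ := hpinv
      refine ⟨n, ?_⟩
      rwa [map_inv₀, inv_pow, ← div_eq_mul_inv, le_div_iff₀, one_mul] at hn
      exact pow_pos (zero_lt_iff.2 ((Valuation.ne_zero_iff _).2 hp0)) _
    -- The extra factor p absorbs t: t lies only in the coarser ring, but pt lies in its maximal
    -- ideal and hence in O.
    refine ⟨n + 1, fun t ht => ?_⟩
    have hpt : O.valuation (p * t) ≤ 1 := by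
      rw [O.valuation_le_one_iff]
      refine ValuationSubring.nonunits_subset
        (ValuationSubring.nonunits_le_nonunits.2 (O.le_localizationRadical hk) ?_)
      change (O.localizationRadical hk).valuation (p * t) < 1
      rw [map_mul]
      exact mul_lt_one_of_lt_of_le hp ((ValuationSubring.valuation_le_one_iff _ _).2 ht)
    have h2 := h (p ^ (n + 1) * t / k) (by
      rw [← O.valuation_le_one_iff, map_div₀, pow_succ, mul_assoc, map_mul, map_pow]
      exact div_le_one_of_le₀ ((mul_le_of_le_one_right' hpt).trans hn) zero_le)
    rwa [mul_div_cancel₀ _ hk0] at h2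

/-- An almost valuation ring `R` squeezed between the maximal ideal of `O` and `O`, such that
`q`-th powers are open in the `R`-topology, gives rise to a proper refinement of `O`. -/
theorem exists_kummerCompatible_lt (hq : q.Prime) (hζ : IsPrimitiveRoot ζ q)
    (O : ValuationSubring K) (R : Subring K) (hMR : ∀ m, O.valuation m < 1 → m ∈ R)
    (hne : ∃ c ∈ O, c ∉ R) {d j : K} (hd : O.valuation d = 1)
    (hdR : ∀ x, x ≠ 0 → x ∈ R ∨ d / x ∈ R) (hj : O.valuation j = 1)
    (hjR : ∀ x ∈ R, 1 + kummerPi q ζ * (j * x) ∈ powSet K q) :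
    ∃ O' : ValuationSubring K, O' < O ∧ KummerCompatible q ζ O' := by
  have hd0 : d ≠ 0 := fun h => by simp [h] at hd
  have hj0 : j ≠ 0 := fun h => by simp [h] at hj
  -- Otherwise every unit of O lying in R is invertible in R. For c ∈ O outside R, c + 1 is outside
  -- too, so c/d and (c + 1)/d are in R. Then d⁻¹, d and finally c are in R.
  obtain ⟨r, hrR, hrM, hrinv⟩ : ∃ r ∈ R, O.valuation r = 1 ∧ r⁻¹ ∉ R := by
    by_contra! hcon
    obtain ⟨c, hcO, hcR⟩ := hne
    have key : ∀ x ∈ O, x ∉ R → x / d ∈ R := by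
      intro x hx hxR
      have hx0 : x ≠ 0 := fun h => hxR (h ▸ zero_mem R)
      have hx1 : O.valuation x = 1 :=
        le_antisymm ((O.valuation_le_one_iff _).2 hx) (not_lt.1 fun h => hxR (hMR x h))
      have := hcon _ ((hdR x hx0).resolve_left hxR) (by rw [map_div₀, hd, hx1, div_one])
      rwa [inv_div] at this
    have h1 := key c hcO hcR
    have h2 := key (c + 1) (O.add_mem _ _ hcO O.one_mem) fun h =>
      hcR (by simpa using sub_mem h (one_mem R))
    have h3 : d⁻¹ ∈ R := by
      convert sub_mem h2 h1 using 1
      ring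
    have h4 := hcon _ h3 (by rw [map_inv₀, hd, inv_one])
    rw [inv_inv] at h4
    refine hcR ?_
    have := mul_mem h1 h4
    rwa [div_mul_cancel₀ _ hd0] at this
  have hr0 : r ≠ 0 := fun h => by simp [h] at hrM
  -- Chevalley's theorem: r is not a unit of R, so some valuation ring above R has r in its maximal
  -- ideal.
  obtain ⟨O', hRO', hrO'⟩ := Ideal.image_subset_nonunits_valuationSubring
    (Ideal.span {(⟨r, hrR⟩ : R)}) (by
      rw [Ne, Ideal.span_singleton_eq_top]
      intro hu
      obtain ⟨s, hs⟩ := isUnit_iff_exists_inv.1 hu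
      have hs' : r * s = 1 := congrArg Subtype.val hs
      exact hrinv (by rw [← eq_inv_of_mul_eq_one_right hs']; exact s.2))
  have hr' : O'.valuation r < 1 :=
    hrO' ⟨⟨r, hrR⟩, Ideal.mem_span_singleton_self _, rfl⟩
  have hrinv' : r⁻¹ ∉ O' := by
    rw [← O'.valuation_le_one_iff, map_inv₀, not_le]
    exact one_lt_inv_iff₀.2 ⟨zero_lt_iff.2 ((Valuation.ne_zero_iff _).2 hr0), hr'⟩
  have hO'O : O' ≤ O := by
    intro x hx
    by_contra hxO
    have h1 : x⁻¹ * r⁻¹ ∈ R := hMR _ (by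
      rw [map_mul, map_inv₀ _ r, hrM, inv_one, mul_one]
      exact O.valuation_inv_lt_one_of_notMem hxO)
    have hx0 : x ≠ 0 := fun h => hxO (h ▸ O.zero_mem)
    refine hrinv' ?_
    have := O'.mul_mem _ _ hx (hRO' h1)
    rwa [mul_inv_cancel_left₀ hx0] at this
  -- If drx ∉ R, then d/(drx) = (rx)⁻¹ is in R, and multiplying by x puts r⁻¹ into `O'`.
  have hbd : ∀ x ∈ O', d * r * x ∈ R := by
    intro x hx
    by_contra hcon
    have hx0 : x ≠ 0 := by
      rintro rfl
      exact hcon (by rw [mul_zero]; exact zero_mem R)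
    have h1 := hRO' ((hdR _ (mul_ne_zero (mul_ne_zero hd0 hr0) hx0)).resolve_left hcon)
    refine hrinv' ?_
    have h2 := O'.mul_mem _ _ hx h1
    convert h2 using 1
    field_simp
  have hk : ∃ k, O.valuation k = 1 ∧ O'.valuation k < 1 ∧
      ∀ x ∈ O', 1 + kummerPi q ζ * (k * x) ∈ powSet K q := by
    have h1 : ∀ x ∈ O', 1 + kummerPi q ζ * ((j * (d * r)) * x) ∈ powSet K q := fun x hx => by
      rw [mul_assoc j]
      exact hjR _ (hbd x hx)
    have hv : O.valuation (j * (d * r)) = 1 := by simp [hd, hj, hrM]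
    -- If jdr is not in the maximal ideal of `O'`, its multiples contain all of `O'`, and r serves
    -- as k.
    rcases lt_or_ge (O'.valuation (j * (d * r))) 1 with h | h
    · exact ⟨_, hv, h, h1⟩
    · refine ⟨r, hrM, hr', fun x hx => ?_⟩
      have hk0 : j * (d * r) ≠ 0 := mul_ne_zero hj0 (mul_ne_zero hd0 hr0)
      have := h1 (r * x / (j * (d * r))) (by
        rw [← O'.valuation_le_one_iff, map_div₀]
        refine div_le_one_of_le₀ (le_trans ?_ h) zero_le
        rw [map_mul]
        exact mul_le_one' hr'.le ((O'.valuation_le_one_iff _).2 hx))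
      rwa [mul_div_cancel₀ _ hk0] at this
  obtain ⟨k, hkO, hkO', hkp⟩ := hk
  have hk0 : k ≠ 0 := fun h => by simp [h] at hkO
  obtain ⟨O'', h1, h2, h3⟩ := exists_kummerCompatible_of_principal hq hζ O' hk0 hkO' hkp
  refine ⟨O'', ?_, h3⟩
  have hkinv : k⁻¹ ∈ O := by rw [← O.valuation_le_one_iff, map_inv₀, hkO, inv_one]
  have hnot : ¬ O ≤ O'' := fun h => h2 (h hkinv)
  -- Overrings of the valuation ring `O'` are comparable, and k⁻¹ lies in O but not in `O''`.
  refine lt_of_le_not_ge ?_ hnot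
  intro x hx
  by_contra hxO
  refine hnot fun y hy => ?_
  have h4 : x⁻¹ * y ∈ O := O.mul_mem _ _ ((O.mem_or_inv_mem x).resolve_left hxO) hy
  have hx0 : x ≠ 0 := fun h => hxO (h ▸ O.zero_mem)
  rcases O'.mem_or_inv_mem (x⁻¹ * y) with h5 | h5
  · have := O''.mul_mem _ _ hx (h1 h5)
    rwa [mul_inv_cancel_left₀ hx0] at this
  · rcases eq_or_ne y 0 with rfl | hy0
    · exact O''.zero_mem
    refine absurd ?_ hxO
    have := O.mul_mem _ _ (hO'O h5) hy
    convert this using 1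
    field_simp

end KummerCompatible

/-! ### Definability by approximation, away from the wild case. -/

section Definable

variable {K : Type*} [Field K] {q : ℕ} {ζ : K}

theorem ValuationSubring.valuation_pow_sub_pow_le (O : ValuationSubring K) {x y : K}
    (hx : O.valuation x ≤ 1) (hy : O.valuation y ≤ 1) (n : ℕ) :
    O.valuation (x ^ n - y ^ n) ≤ O.valuation (x - y) := by
  induction n with
  | zero => simp
  | succ n ih =>
    have : x ^ (n + 1) - y ^ (n + 1) = (x ^ n - y ^ n) * x + (x - y) * y ^ n := by ring
    rw [this]
    refine Valuation.map_add_le _ ?_ ?_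
    · rw [map_mul]
      exact (mul_le_of_le_one_right' hx).trans ih
    · rw [map_mul, map_pow]
      exact mul_le_of_le_one_right' (pow_le_one₀ zero_le hy)

theorem valuation_kummerMap_sub_le (hq : q.Prime) (hζ : IsPrimitiveRoot ζ q)
    (O : ValuationSubring K) {x y : K} (hx : O.valuation x ≤ 1) (hy : O.valuation y ≤ 1) :
    O.valuation (kummerMap q ζ x - kummerMap q ζ y) ≤ O.valuation (x - y) := by
  rw [kummerMap_eq hq hζ, kummerMap_eq hq hζ, add_sub_add_comm]
  refine Valuation.map_add_le _ ?_ ?_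
  · rw [← mul_sub, map_mul, valuation_kummerLead O hq hζ, one_mul]
    exact O.valuation_pow_sub_pow_le hx hy q
  · rw [kummerTail, kummerTail, Finset.mul_sum, Finset.mul_sum, ← Finset.sum_sub_distrib]
    refine Valuation.map_sum_le _ fun i _ => ?_
    have : x * (((q.choose (i + 1) / q : ℕ) : K) * ((1 - ζ) * x) ^ i) -
        y * (((q.choose (i + 1) / q : ℕ) : K) * ((1 - ζ) * y) ^ i) =
        (((q.choose (i + 1) / q : ℕ) : K) * (1 - ζ) ^ i) * (x ^ (i + 1) - y ^ (i + 1)) := by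
      simp only [mul_pow]
      ring
    rw [this, map_mul, map_mul, map_pow]
    exact (mul_le_of_le_one_left' (mul_le_one' (O.valuation_natCast_le_one _)
      (pow_le_one₀ zero_le (valuation_one_sub_le O hq hζ)))).trans
      (O.valuation_pow_sub_pow_le hx hy _)

theorem ValuationSubring.definable_of_maximalIdeal (O : ValuationSubring K)
    (h : IsRingDefinable {x | O.valuation x < 1}) : IsRingDefinable (O : Set K) := by
  have : (O : Set K) = {x | x = 0 ∨ ¬ x⁻¹ ∈ {x | O.valuation x < 1}} := by
    ext x
    rcases eq_or_ne x 0 with rfl | hx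
    · simp [O.zero_mem]
    · simp only [SetLike.mem_coe, Set.mem_ofPred_eq, hx, false_or, map_inv₀, not_lt]
      rw [← O.valuation_le_one_iff, one_le_inv_iff₀]
      simp [zero_lt_iff, hx]
  rw [this]
  refine isRingDefinable_iff.2 (.or (.eq (.proj _) (.const _)) (.not (.mem h (.inv (.proj _)))))

/-- If the one-units and the units of a valuation ring are `q`-th powers, then it has a non-trivial
definable coarsening. -/
theorem exists_definable_of_units (O : ValuationSubring K)
    (hM : ∀ m, O.valuation m < 1 → 1 + m ∈ powSet K q)
    (hU : ∀ x, O.valuation x = 1 → x ∈ powSet K q) (hG : ∃ a : K, a ≠ 0 ∧ a ∉ powSet K q) :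
    ∃ W : ValuationSubring K, W ≠ ⊤ ∧ IsRingDefinable (W : Set K) := by
  set D : Set K := {x | x ≠ 0 ∧ x ∉ powSet K q ∧ 1 + x ∈ powSet K q} with hD
  -- D consists of the elements of 𝔪 that are neither 0 nor `q`-th powers: for v(x) > 1, x = (1 +
  -- x)/(1 + x⁻¹) would be a `q`-th power.
  have memD : ∀ x, x ∈ D ↔ x ≠ 0 ∧ x ∉ powSet K q ∧ O.valuation x < 1 := by
    intro x
    refine ⟨fun ⟨h0, h1, h2⟩ => ⟨h0, h1, ?_⟩, fun ⟨h0, h1, h2⟩ => ⟨h0, h1, hM x h2⟩⟩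
    rcases lt_trichotomy (O.valuation x) 1 with h | h | h
    · exact h
    · exact absurd (hU x h) h1
    · have h3 := hM x⁻¹ (by rw [map_inv₀]; exact inv_lt_one_of_one_lt₀ h)
      have h4 := powSet.div_mem h2 h3
      have h5 : (1 + x) / (1 + x⁻¹) = x := by
        rw [div_eq_iff h3.1]
        field_simp
        ring
      exact absurd (h5 ▸ h4) h1
  have hDM : ∀ x ∈ D, O.valuation x < 1 := fun x hx => ((memD x).1 hx).2.2
  have hDdef : IsRingDefinable D := by
    refine isRingDefinable_iff.2 (.and (.not (.eq (.proj _) (.const _))) (.and (.not ?_) ?_))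
    · exact .mem powSet.definable (.proj _)
    · exact .mem powSet.definable (.add (.const _) (.proj _))
  have hPD : ∀ x y, x ∈ powSet K q → y ∈ D → O.valuation (x * y) < 1 → x * y ∈ D := by
    intro x y hx hy h
    exact (memD _).2 ⟨mul_ne_zero hx.1 hy.1, fun h1 => hy.2.1 ((powSet.mul_mem_iff hx).1 h1), h⟩
  -- A non-zero x that is neither in D nor a `q`-th power has x⁻¹ ∈ D, contradicting x · x⁻¹ = 1.
  have hcases : ∀ x, (∀ y ∈ D, O.valuation (x * y) < 1) → x = 0 ∨ x ∈ D ∨ x ∈ powSet K q := by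
    intro x hx
    refine or_iff_not_imp_left.2 fun hx0 => or_iff_not_imp_right.2 fun hxP => ?_
    refine (memD x).2 ⟨hx0, hxP, ?_⟩
    by_contra! h
    have h1 : O.valuation x ≠ 1 := fun h1 => hxP (hU x h1)
    have h2 : x⁻¹ ∈ D := (memD _).2 ⟨inv_ne_zero hx0, fun h3 => hxP (powSet.inv_mem_iff.1 h3), by
      rw [map_inv₀]; exact inv_lt_one_of_one_lt₀ (lt_of_le_of_ne h h1.symm)⟩
    simpa [mul_inv_cancel₀ hx0] using hx _ h2
  let R : Subring K :=
    { carrier := {x | ∀ y ∈ D, O.valuation (x * y) < 1}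
      one_mem' := fun y hy => by simpa using hDM y hy
      zero_mem' := fun y _ => by simp
      neg_mem' := fun {x} hx y hy => by simpa using hx y hy
      add_mem' := fun {a b} ha hb y hy => by
        rw [add_mul]
        exact O.valuation_add_lt_one (ha y hy) (hb y hy)
      mul_mem' := fun {a b} ha hb y hy => by
        rcases hcases b hb with rfl | h | h
        · simp
        · rw [map_mul]
          exact mul_lt_one_of_lt_of_le (ha b h) (hDM y hy).le
        · rw [mul_assoc]
          exact ha _ (hPD b y h hy (hb y hy)) }
  have hOR : O.toSubring ≤ R := fun x hx y hy => by
    rw [mul_comm, map_mul]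
    exact mul_lt_one_of_lt_of_le (hDM y hy) ((O.valuation_le_one_iff _).2 hx)
  refine ⟨O.ofLE R hOR, ?_, ?_⟩
  · intro htop
    have hall : ∀ x, ∀ y ∈ D, O.valuation (x * y) < 1 := fun x => by
      have : x ∈ O.ofLE R hOR := htop ▸ ValuationSubring.mem_top x
      exact this
    obtain ⟨a, ha0, ha⟩ := hG
    have h1 := ((hcases a (hall a)).resolve_left ha0).resolve_right ha
    simpa [inv_mul_cancel₀ ha0] using hall a⁻¹ a h1
  -- The condition xy ∈ 𝔪 is not visibly definable, but for a `q`-th power x and y ∈ D it is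
  -- equivalent to xy ∈ D.
  · have : (O.ofLE R hOR : Set K) =
        {x | x = 0 ∨ x ∈ D ∨ (x ∈ powSet K q ∧ ∀ y, y ∈ D → x * y ∈ D)} := by
      ext x
      change (∀ y ∈ D, O.valuation (x * y) < 1) ↔ _
      constructor
      · intro hx
        rcases hcases x hx with h | h | h
        · exact Or.inl h
        · exact Or.inr (Or.inl h)
        · exact Or.inr (Or.inr ⟨h, fun y hy => hPD x y h hy (hx y hy)⟩)
      · rintro (rfl | h | ⟨-, h⟩) y hy
        · simp
        · rw [map_mul]
          exact mul_lt_one_of_lt_of_le (hDM x h) (hDM y hy).le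
        · exact hDM _ (h y hy)
    rw [this]
    refine isRingDefinable_iff.2 (.or (.eq (.proj _) (.const _)) (.or (.mem hDdef (.proj _))
      (.and (.mem powSet.definable (.proj _)) (.all (.imp ?_ ?_)))))
    · exact .mem hDdef (.proj _)
    · exact .mem hDdef (.mul (.proj _) (.proj _))

/-- A minimal Kummer compatible valuation ring is definable as soon as it is approximated by a
definable set, and not all elements `1 + q (1 - ζ) x` with `x` integral are `q`-th powers. -/
theorem definable_of_approx (hq : q.Prime) (hζ : IsPrimitiveRoot ζ q) (O : ValuationSubring K)
    (hMC : KummerCompatible q ζ O)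
    (hmin : ∀ O' < O, ¬ KummerCompatible q ζ O') {S : Set K} (hS : IsRingDefinable S)
    (hMS : ∀ m, O.valuation m < 1 → m ∈ S) (hSO : ∀ x ∈ S, x ∈ O)
    (hadd : ∀ m, O.valuation m < 1 → ∀ x ∈ S, m + x ∈ S)
    {b : K} (hb : b ∈ O) (hbP : 1 + kummerPi q ζ * b ∉ powSet K q) :
    IsRingDefinable (O : Set K) := by
  have hMA : ∀ m, O.valuation m < 1 → m ∈ addStab S := fun m hm =>
    mem_addStab_of_add_mem (hadd m hm) (hadd (-m) (by rwa [Valuation.map_neg]))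
  have hAO : ∀ x ∈ addStab S, O.valuation x ≤ 1 := fun x hx =>
    (O.valuation_le_one_iff x).2 (hSO x (addStab_subset (hMS 0 (by simp)) hx))
  have hMR : ∀ m, O.valuation m < 1 → m ∈ stabSubring S := fun m hm y hy => hMA _ (by
    rw [map_mul]; exact mul_lt_one_of_lt_of_le hm (hAO y hy))
  have hRO : ∀ x ∈ stabSubring S, x ∈ O := by
    intro x hx
    by_contra hxO
    have hx0 : x ≠ 0 := fun h => hxO (h ▸ O.zero_mem)
    have h1 := hx _ (hMA _ (O.valuation_inv_lt_one_of_notMem hxO))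
    rw [mul_inv_cancel₀ hx0] at h1
    have h2 := hAO _ (hx _ h1)
    rw [mul_one, O.valuation_le_one_iff] at h2
    exact hxO h2
  have hRdef := hS.stabSubring
  generalize stabSubring S = R at hMR hRO hRdef
  by_cases hne : ∃ c ∈ O, c ∉ R
  swap
  · push Not at hne
    convert hRdef using 1
    exact Set.Subset.antisymm hne hRO
  -- J and N collect the admissible constants j and d of `exists_kummerCompatible_lt`. Both are
  -- definable and lie between 𝔪 and O. If either equals 𝔪, then O is definable; otherwise both
  -- contain units, contradicting minimality.
  set J : Set K := {x | ∀ r, r ∈ R → 1 + kummerPi q ζ * (x * r) ∈ powSet K q} with hJ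
  have hJdef : IsRingDefinable J := by
    refine isRingDefinable_iff.2 (.all (.imp ?_ ?_))
    · exact .mem hRdef (.proj _)
    · exact .mem powSet.definable (.add (.const _) (.mul (.const _) (.mul (.proj _) (.proj _))))
  -- Taking r = 1 gives the dichotomy x ∈ R or d/x ∈ R. General r forces N ⊆ O: for d ∉ O and c ∈ O
  -- outside R, r = c²/d is in 𝔪 and cc = dr.
  set N : Set K := {d | ∀ x y r, r ∈ R → x * y = d * r → x ∈ R ∨ y ∈ R} with hN
  have hNdef : IsRingDefinable N := by
    refine isRingDefinable_iff.2 (.all (.all (.all (.imp ?_ (.imp ?_ (.or ?_ ?_))))))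
    · exact .mem hRdef (.proj _)
    · exact .eq (.mul (.proj _) (.proj _)) (.mul (.proj _) (.proj _))
    · exact .mem hRdef (.proj _)
    · exact .mem hRdef (.proj _)
  have hMJ : ∀ m, O.valuation m < 1 → m ∈ J := fun m hm r hr => hMC _ (by
    rw [map_mul]; exact mul_lt_one_of_lt_of_le hm ((O.valuation_le_one_iff r).2 (hRO r hr)))
  have hJO : ∀ x ∈ J, O.valuation x ≤ 1 := by
    intro x hx
    rw [O.valuation_le_one_iff]
    by_contra hxO
    have hx0 : x ≠ 0 := fun h => hxO (h ▸ O.zero_mem)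
    have h1 := hx (x⁻¹ * b) (hMR _ (by
      rw [map_mul]
      exact mul_lt_one_of_lt_of_le (O.valuation_inv_lt_one_of_notMem hxO)
        ((O.valuation_le_one_iff b).2 hb)))
    rw [mul_inv_cancel_left₀ hx0] at h1
    exact hbP h1
  have hMN : ∀ m, O.valuation m < 1 → m ∈ N := by
    intro m hm x y r hr hxy
    by_contra! hcon
    have h1 : ∀ z, z ∉ R → 1 ≤ O.valuation z := fun z hz => not_lt.1 fun h => hz (hMR z h)
    have h2 := one_le_mul (h1 x hcon.1) (h1 y hcon.2)
    rw [← map_mul, hxy, map_mul] at h2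
    exact absurd (mul_lt_one_of_lt_of_le hm ((O.valuation_le_one_iff r).2 (hRO r hr))) (not_lt.2 h2)
  have hNO : ∀ x ∈ N, O.valuation x ≤ 1 := by
    intro d hd
    rw [O.valuation_le_one_iff]
    by_contra hdO
    have hd0 : d ≠ 0 := fun h => hdO (h ▸ O.zero_mem)
    obtain ⟨c, hcO, hcR⟩ := hne
    have := hd c c (d⁻¹ * (c * c)) (hMR _ (by
      rw [map_mul]
      exact mul_lt_one_of_lt_of_le (O.valuation_inv_lt_one_of_notMem hdO)
        ((O.valuation_le_one_iff _).2 (O.mul_mem _ _ hcO hcO)))) (mul_inv_cancel_left₀ hd0 _).symm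
    exact hcR (this.elim id id)
  by_cases hJM : ∀ x ∈ J, O.valuation x < 1
  · refine O.definable_of_maximalIdeal ?_
    convert hJdef using 1
    exact Set.Subset.antisymm hMJ hJM
  by_cases hNM : ∀ x ∈ N, O.valuation x < 1
  · refine O.definable_of_maximalIdeal ?_
    convert hNdef using 1
    exact Set.Subset.antisymm hMN hNM
  push Not at hJM hNM
  obtain ⟨j, hj, hj1⟩ := hJM
  obtain ⟨d, hd, hd1⟩ := hNM
  obtain ⟨O', hO', hcomp⟩ := exists_kummerCompatible_lt hq hζ O R hMR hne
    (le_antisymm (hNO d hd) hd1) (fun x hx => hd x (d / x) 1 (one_mem R) (by field_simp))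
    (le_antisymm (hJO j hj) hj1) hj
  exact absurd hcomp (hmin O' hO')

/-- The case of residue characteristic different from `q`. -/
theorem definable_of_unit_notMem (hq : q.Prime) (hζ : IsPrimitiveRoot ζ q)
    (hneg : (-1 : K) ∈ powSet K q) (O : ValuationSubring K) (hO : KummerCompatible q ζ O)
    (hmin : ∀ O' < O, ¬ KummerCompatible q ζ O') (hqO : O.valuation (kummerPi q ζ) = 1)
    {a : K} (ha1 : O.valuation a = 1) (ha : a ∉ powSet K q) : IsRingDefinable (O : Set K) := by
  have ha0 : a ≠ 0 := fun h => by simp [h] at ha1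
  have hpi := kummerPi_ne_zero hq hζ
  have hM : ∀ m, O.valuation m < 1 → 1 + m ∈ powSet K q := fun m hm => by
    have := hO (m / kummerPi q ζ) (by rwa [map_div₀, hqO, div_one])
    rwa [mul_div_cancel₀ _ hpi] at this
  set S : Set K := {x | (a - x ^ q) / a ∈ powSet K q} with hSdef
  have hnot : ∀ x, x ^ q / a ∉ powSet K q := by
    intro x h
    have hx : x ≠ 0 := by
      rintro rfl
      simp [zero_pow hq.ne_zero, powSet.zero_notMem] at h
    have h3 := powSet.div_mem (powSet.pow_mem (q := q) hx) h
    rw [div_div_cancel₀ (pow_ne_zero _ hx)] at h3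
    exact ha h3
  have hSO : ∀ x ∈ S, O.valuation x ≤ 1 := by
    intro x hx
    by_contra! h
    have hx0 : x ≠ 0 := fun h0 => by simp [h0] at h
    have h1 := hM (-(a / x ^ q)) (by
      rw [Valuation.map_neg, map_div₀, ha1, map_pow, one_div]
      exact inv_lt_one_of_one_lt₀ (one_lt_pow₀ h hq.ne_zero))
    have h2 := powSet.div_mem hx (powSet.mul_mem hneg h1)
    refine hnot x ?_
    convert h2 using 1
    have h4 : (1 + -(a / x ^ q)) = (x ^ q - a) / x ^ q := by
      field_simp
      ring
    have h5 : x ^ q - a ≠ 0 := by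
      intro h6
      rw [h4, h6, zero_div] at h1
      exact h1.1 rfl
    rw [h4]
    field_simp
    ring
  -- As π is a unit, b = -π⁻¹ is integral, and 1 + πb = 0 is not a non-zero `q`-th power.
  refine definable_of_approx hq hζ O hO hmin (S := S) ?_ ?_ (fun x hx =>
    (O.valuation_le_one_iff x).1 (hSO x hx)) ?_ (b := -(kummerPi q ζ)⁻¹) ?_ ?_
  · exact isRingDefinable_iff.2 (.mem powSet.definable
      (.div (.sub (.const _) (.pow (.proj _) _)) (.const _)))
  · intro m hm
    have := hM (-(m ^ q / a)) (by
      rw [Valuation.map_neg, map_div₀, ha1, div_one, map_pow]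
      exact pow_lt_one₀ zero_le hm hq.ne_zero)
    change (a - m ^ q) / a ∈ powSet K q
    convert this using 1
    field_simp
    ring
  · intro m hm x hx
    have hxO := hSO x hx
    have h1 : O.valuation (a - x ^ q) = 1 := by
      refine le_antisymm (Valuation.map_sub_le _ ha1.le ?_) (not_lt.1 fun h => ?_)
      · rw [map_pow]
        exact pow_le_one₀ zero_le hxO
      · have := hM (-((a - x ^ q) / a)) (by rwa [Valuation.map_neg, map_div₀, ha1, div_one])
        refine hnot x ?_
        convert this using 1
        field_simp
        ring
    have h0 : a - x ^ q ≠ 0 := fun h => by simp [h] at h1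
    have h2 := hM (-(((m + x) ^ q - x ^ q) / (a - x ^ q))) (by
      rw [Valuation.map_neg, map_div₀, h1, div_one]
      refine lt_of_le_of_lt (O.valuation_pow_sub_pow_le
        (Valuation.map_add_le _ hm.le hxO) hxO q) ?_
      rwa [add_sub_cancel_right])
    have h3 := powSet.mul_mem hx h2
    change (a - (m + x) ^ q) / a ∈ powSet K q
    convert h3 using 1
    field_simp
    ring
  · rw [← O.valuation_le_one_iff, Valuation.map_neg, map_inv₀, hqO, inv_one]
  · rw [mul_neg, mul_inv_cancel₀ hpi, add_neg_cancel]
    exact powSet.zero_notMem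

/-- The case of residue characteristic `q`, with a residue field which is not closed under
Artin-Schreier extensions. -/
theorem definable_of_artinSchreier (hq : q.Prime) (hζ : IsPrimitiveRoot ζ q)
    (O : ValuationSubring K) (hO : KummerCompatible q ζ O)
    (hmin : ∀ O' < O, ¬ KummerCompatible q ζ O') (hqO : O.valuation (1 - ζ) < 1)
    {b : K} (hb : b ∈ O) (hbP : 1 + kummerPi q ζ * b ∉ powSet K q) : IsRingDefinable (O : Set K) := by
  rw [← O.valuation_le_one_iff] at hb
  have hpi : O.valuation (kummerPi q ζ) < 1 := by
    rw [valuation_kummerPi O hq hζ]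
    exact pow_lt_one₀ zero_le hqO hq.ne_zero
  have hunit : ∀ x, O.valuation x ≤ 1 → O.valuation (1 + kummerPi q ζ * x) = 1 := fun x hx =>
    O.valuation_one_add (by rw [map_mul]; exact mul_lt_one_of_lt_of_le hpi hx)
  -- For integral x, whether 1 + πx is a `q`-th power depends only on x modulo 𝔪: (1 + πx)/(1 + πy)
  -- = 1 + π(x - y)/(1 + πy).
  have hstable : ∀ x y, O.valuation x ≤ 1 → O.valuation (y - x) < 1 →
      1 + kummerPi q ζ * x ∉ powSet K q → 1 + kummerPi q ζ * y ∉ powSet K q := by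
    intro x y hx hxy hxP hyP
    have hy : O.valuation y ≤ 1 := by
      have := Valuation.map_add_le O.valuation hxy.le hx
      rwa [sub_add_cancel] at this
    have h1 := hO ((x - y) / (1 + kummerPi q ζ * y)) (by
      rwa [map_div₀, hunit y hy, div_one, Valuation.map_sub_swap])
    refine hxP ?_
    convert powSet.mul_mem hyP h1 using 1
    have := hyP.1
    field_simp
    ring
  have hb1 : O.valuation b = 1 := le_antisymm hb (not_lt.1 fun h => hbP (hO b h))
  have hb0 : b ≠ 0 := fun h => by simp [h] at hb1
  have hden : ∀ z, O.valuation z ≤ 1 → O.valuation (b - kummerMap q ζ z) = 1 := by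
    intro z hz
    have hF := (valuation_kummerMap_le O hq hζ hz).trans hz
    refine le_antisymm (Valuation.map_sub_le _ hb hF) (not_lt.1 fun h => ?_)
    refine hstable b (kummerMap q ζ z) hb (by rwa [Valuation.map_sub_swap]) hbP ?_
    have h1 := hunit _ hF
    rw [one_add_kummerPi_mul_kummerMap hq hζ] at h1 ⊢
    refine powSet.pow_mem fun h0 => ?_
    rw [h0, zero_pow hq.ne_zero, map_zero] at h1
    exact zero_ne_one h1
  have hnum : ∀ z, O.valuation z ≤ 1 → O.valuation (b ^ 2 / (b - kummerMap q ζ z)) ≤ 1 := fun z hz => by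
    rw [map_div₀, hden z hz, div_one, map_pow, hb1, one_pow]
  have hSO : ∀ z, 1 + kummerPi q ζ * (b ^ 2 / (b - kummerMap q ζ z)) ∉ powSet K q →
      O.valuation z ≤ 1 := by
    intro z hz
    by_contra! h
    refine hz (hO _ ?_)
    have h1 : 1 < O.valuation (kummerMap q ζ z) := by
      rw [valuation_kummerMap_of_one_lt O hq hζ h]
      exact one_lt_pow₀ h hq.ne_zero
    rw [map_div₀, map_pow, hb1, one_pow, Valuation.map_sub_eq_of_lt_right _ (by rwa [hb1]), one_div]
    exact inv_lt_one_of_one_lt₀ h1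
  -- The expression b²/(b - F(z)) is congruent to b for z ∈ 𝔪 and lies in 𝔪 for z ∉ O. Its
  -- denominator is a unit on O because 1 + πF(z) is a `q`-th power and 1 + πb is not.
  refine definable_of_approx hq hζ O hO hmin
    (S := {z | 1 + kummerPi q ζ * (b ^ 2 / (b - kummerMap q ζ z)) ∉ powSet K q}) ?_ ?_
    (fun z hz => (O.valuation_le_one_iff z).1 (hSO z hz)) ?_
    ((O.valuation_le_one_iff b).1 hb) hbP
  · refine isRingDefinable_iff.2 (.not (.mem powSet.definable (.add (.const _) (.mul (.const _)
      (.div (.const _) (.sub (.const _) (.div (.sub (.pow (.add (.const _) (.mul (.const _)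
        (.proj _))) _) (.const _)) (.const _))))))))
  · intro m hm
    refine hstable b _ hb ?_ hbP
    have h1 := hden m hm.le
    have h0 : b - kummerMap q ζ m ≠ 0 := fun h => by simp [h] at h1
    have : b ^ 2 / (b - kummerMap q ζ m) - b = b * kummerMap q ζ m / (b - kummerMap q ζ m) := by
      field_simp
      ring
    rw [this, map_div₀, h1, div_one, map_mul, hb1, one_mul]
    exact lt_of_le_of_lt (valuation_kummerMap_le O hq hζ hm.le) hm
  · intro m hm z hz
    have hz1 := hSO z hz
    have hmz := Valuation.map_add_le O.valuation hm.le hz1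
    refine hstable _ _ (hnum z hz1) ?_ hz
    have h1 := hden z hz1
    have h2 := hden (m + z) hmz
    have h1' : b - kummerMap q ζ z ≠ 0 := fun h => by simp [h] at h1
    have h2' : b - kummerMap q ζ (m + z) ≠ 0 := fun h => by simp [h] at h2
    have : b ^ 2 / (b - kummerMap q ζ (m + z)) - b ^ 2 / (b - kummerMap q ζ z) =
        b ^ 2 * (kummerMap q ζ (m + z) - kummerMap q ζ z) /
          ((b - kummerMap q ζ (m + z)) * (b - kummerMap q ζ z)) := by
      field_simp
      ring
    rw [this, map_div₀, map_mul, map_mul, h1, h2, one_mul, div_one, map_pow, hb1, one_pow, one_mul]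
    refine lt_of_le_of_lt (valuation_kummerMap_sub_le hq hζ O hmz hz1) ?_
    rwa [add_sub_cancel_right]

end Definable

/-! ### The wild case: all of 1 + πO consists of `q`-th powers. -/

section WildCase

variable {K : Type*} [Field K] {q : ℕ} {ζ : K}

/-- The localization of a valuation ring at the powers of an element of it. -/
def ValuationSubring.invAdjoin (O : ValuationSubring K) {s : K} (hs : O.valuation s ≤ 1) :
    ValuationSubring K :=
  have hsn : ∀ n : ℕ, s ^ n ∈ O := fun n => pow_mem ((O.valuation_le_one_iff s).1 hs) n
  O.ofLE
    { carrier := {x | ∃ n : ℕ, s ^ n * x ∈ O}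
      one_mem' := ⟨0, by simp⟩
      zero_mem' := ⟨0, by simp⟩
      neg_mem' := by
        rintro x ⟨n, hn⟩
        exact ⟨n, by rw [mul_neg]; exact O.neg_mem _ hn⟩
      mul_mem' := by
        rintro x y ⟨n, hn⟩ ⟨m, hm⟩
        refine ⟨n + m, ?_⟩
        convert O.mul_mem _ _ hn hm using 1
        ring
      add_mem' := by
        rintro x y ⟨n, hn⟩ ⟨m, hm⟩
        refine ⟨n + m, ?_⟩
        convert O.add_mem _ _ (O.mul_mem _ _ (hsn m) hn) (O.mul_mem _ _ (hsn n) hm) using 1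
        ring }
    fun x hx => ⟨0, by simpa using hx⟩

theorem ValuationSubring.le_invAdjoin {O : ValuationSubring K} {s : K} (hs : O.valuation s ≤ 1) :
    O ≤ O.invAdjoin hs := fun x hx => ⟨0, by simpa using hx⟩

variable {O : ValuationSubring K}

/-- If all elements `1 + q (1 - ζ) x / s ^ q` are `q`-th powers, then every integral element is a
`q`-th power up to a small error. -/
theorem exists_pow_approx (hq : q.Prime) (hζ : IsPrimitiveRoot ζ q) {s : K} (hs0 : s ≠ 0)
    (hs : O.valuation s < 1)
    (h : ∀ x, O.valuation x ≤ 1 → 1 + kummerPi q ζ * (x / s ^ q) ∈ powSet K q) {u : K}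
    (hu : O.valuation u ≤ 1) :
    ∃ y l, O.valuation y ≤ 1 ∧ O.valuation l ≤ 1 ∧ u - y ^ q = s ^ (q - 1) * y * l := by
  have hpi := kummerPi_ne_zero hq hζ
  have hlam := one_sub_ne_zero_of_isPrimitiveRoot hq hζ
  have hlead := kummerLead_ne_zero hq hζ
  have hvlead := valuation_kummerLead O hq hζ
  -- Otherwise x = -s^q/π would be integral and 1 + πx/s^q = 0.
  have hpis : O.valuation (kummerPi q ζ / s ^ q) < 1 := by
    by_contra! hcon
    have h1 := h (-(kummerPi q ζ / s ^ q)⁻¹) (by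
      rw [Valuation.map_neg, map_inv₀]; exact inv_le_one_of_one_le₀ hcon)
    refine h1.1 ?_
    field_simp
    ring
  -- Writing the root as c = 1 + (1 - ζ)z gives F(z) = `kummerLead` · u/s^q. Clearing denominators,
  -- y = sz approximates a `q`-th root of u, and the tail supplies the error.
  obtain ⟨hc0, c, hc⟩ := h (kummerLead q ζ * u) (by rw [map_mul, hvlead, one_mul]; exact hu)
  have hvc : O.valuation c = 1 := by
    refine (pow_eq_one_iff.1 (?_ : O.valuation c ^ q = 1)).resolve_right hq.ne_zero
    rw [← map_pow, hc]
    refine O.valuation_one_add ?_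
    have : kummerPi q ζ * (kummerLead q ζ * u / s ^ q) =
      (kummerPi q ζ / s ^ q) * (kummerLead q ζ * u) := by ring
    rw [this, map_mul]
    refine mul_lt_one_of_lt_of_le hpis ?_
    rw [map_mul, hvlead, one_mul]
    exact hu
  have hz : (1 - ζ) * ((c - 1) / (1 - ζ)) = c - 1 := mul_div_cancel₀ _ hlam
  have hF : kummerMap q ζ ((c - 1) / (1 - ζ)) = kummerLead q ζ * u / s ^ q := by
    have h1 := one_add_kummerPi_mul_kummerMap hq hζ ((c - 1) / (1 - ζ))
    rw [hz, add_sub_cancel, hc] at h1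
    exact mul_left_cancel₀ hpi (add_left_cancel h1)
  have htail := valuation_kummerTail_le O (q := q) (ζ := ζ) (z := (c - 1) / (1 - ζ)) (by
    rw [hz]
    exact Valuation.map_sub_le _ hvc.le (by rw [map_one]))
  rw [kummerMap_eq hq hζ] at hF
  set z := (c - 1) / (1 - ζ)
  have hl : O.valuation (kummerTail q ζ z / kummerLead q ζ) ≤ 1 := by
    rwa [map_div₀, hvlead, div_one]
  have key : u - (s * z) ^ q = s ^ (q - 1) * (s * z) * (kummerTail q ζ z / kummerLead q ζ) := by
    have h1 : s ^ (q - 1) * s = s ^ q := by rw [← pow_succ, Nat.sub_add_cancel hq.one_le]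
    have h2 : s ^ (q - 1) * (s * z) * (kummerTail q ζ z / kummerLead q ζ) =
      s ^ q * (z * kummerTail q ζ z) / kummerLead q ζ := by
      rw [← h1]
      ring
    rw [h2, mul_pow, eq_div_iff hlead]
    rw [eq_div_iff (pow_ne_zero _ hs0)] at hF
    linear_combination -hF
  refine ⟨s * z, _, ?_, hl, key⟩
  by_contra! hcon
  have h1 : O.valuation (s * z) < O.valuation (s * z) ^ q := by
    conv_lhs => rw [← pow_one (O.valuation (s * z))]
    exact pow_lt_pow_right₀ hcon hq.one_lt
  have h2 : O.valuation (u - (s * z) ^ q) = O.valuation (s * z) ^ q := by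
    rw [Valuation.map_sub_eq_of_lt_right, map_pow]
    rw [map_pow]
    exact (hu.trans_lt hcon).trans h1
  rw [key, map_mul, map_mul _ (s ^ (q - 1)), map_pow _ s] at h2
  refine absurd h2 (ne_of_lt (lt_of_le_of_lt ?_ h1))
  refine (mul_le_of_le_one_right' hl).trans (mul_le_of_le_one_left' ?_)
  exact pow_le_one₀ zero_le hs.le

/-- Approximability by `q`-th powers makes elements of small value `q`-th powers up to a unit. -/
theorem exists_pow_eq_mul_unit (hq : q.Prime) {s : K} (hs0 : s ≠ 0) (hs : O.valuation s < 1)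
    (h : ∀ u, O.valuation u ≤ 1 → ∃ y l, O.valuation y ≤ 1 ∧ O.valuation l ≤ 1 ∧
      u - y ^ q = s ^ (q - 1) * y * l) {x : K} (hx : O.valuation x ≤ 1)
    (hsx : O.valuation s ≤ O.valuation x) : ∃ y w, O.valuation w = 1 ∧ y ^ q = x * w := by
  obtain ⟨y, l, hy, hl, hyl⟩ := h x hx
  have hq1 : q - 1 ≠ 0 := Nat.sub_ne_zero_of_lt hq.one_lt
  have hvs : O.valuation s ≠ 0 := (Valuation.ne_zero_iff _).2 hs0
  have hvx : 0 < O.valuation x := lt_of_lt_of_le (zero_lt_iff.2 hvs) hsx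
  have hx0 : x ≠ 0 := (Valuation.ne_zero_iff _).1 hvx.ne'
  refine ⟨y, 1 - s ^ (q - 1) * y * l / x, ?_, ?_⟩
  · rw [sub_eq_add_neg]
    refine O.valuation_one_add ?_
    rw [Valuation.map_neg, map_div₀, div_lt_one₀ hvx, map_mul, map_mul, map_pow]
    refine lt_of_le_of_lt (mul_le_of_le_one_right' hl) ?_
    rcases hx.lt_or_eq with hx1 | hx1
    · have hy1 : O.valuation y < 1 := by
        refine lt_of_le_of_ne hy fun hy1 => ?_
        have h1 : O.valuation (x - s ^ (q - 1) * y * l) < 1 := by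
          refine Valuation.map_sub_lt _ hx1 ?_
          rw [map_mul, map_mul, map_pow, mul_assoc]
          exact mul_lt_one_of_lt_of_le (pow_lt_one₀ zero_le hs hq1) (mul_le_one' hy hl)
        rw [← hyl, sub_sub_cancel, map_pow, hy1, one_pow] at h1
        exact lt_irrefl _ h1
      calc O.valuation s ^ (q - 1) * O.valuation y ≤ O.valuation s * O.valuation y :=
            mul_le_mul_left (pow_le_of_le_one zero_le hs.le hq1) _
        _ < O.valuation s * 1 := mul_lt_mul_of_pos_left hy1 (zero_lt_iff.2 hvs)
        _ ≤ _ := by rwa [mul_one]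
    · rw [hx1]
      exact mul_lt_one_of_lt_of_le (pow_lt_one₀ zero_le hs hq1) hy
  · rw [mul_sub, mul_one, mul_div_cancel₀ _ hx0, ← hyl, sub_sub_cancel]

/-- If integral elements are approximated by `q`-th powers to an order to which being near `1`
implies being a `q`-th power, then there is a coarsening whose units are `q`-th powers. -/
theorem exists_units_mem_of_pow_approx (hq : q.Prime) {s : K} (hs0 : s ≠ 0)
    (hs : O.valuation s < 1)
    (h : ∀ u, O.valuation u ≤ 1 → ∃ y l, O.valuation y ≤ 1 ∧ O.valuation l ≤ 1 ∧
      u - y ^ q = s ^ (q - 1) * y * l)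
    (hs1 : ∀ x, O.valuation x ≤ 1 → 1 + s * x ∈ powSet K q) :
    ∃ O' : ValuationSubring K, (∀ m, O'.valuation m < 1 → 1 + m ∈ powSet K q) ∧
      ∀ x, O'.valuation x = 1 → x ∈ powSet K q := by
  have hvs : 0 < O.valuation s := zero_lt_iff.2 ((Valuation.ne_zero_iff _).2 hs0)
  have hunit : ∀ x, O.valuation x = 1 → x ∈ powSet K q := by
    intro x hx
    obtain ⟨y, l, hy, hl, hyl⟩ := h x hx.le
    have hsq : s ^ (q - 1) = s * s ^ (q - 2) := by
      rw [← pow_succ']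
      congr 1
      have := hq.two_le
      omega
    have hvsq : O.valuation (s ^ (q - 2) * y * l) ≤ 1 := by
      rw [map_mul, map_mul, map_pow]
      exact mul_le_one' (mul_le_one' (pow_le_one₀ zero_le hs.le) hy) hl
    have hy1 : O.valuation (y ^ q) = 1 := by
      have h1 : O.valuation (x - y ^ q) < 1 := by
        rw [hyl, hsq, mul_assoc, mul_assoc, ← mul_assoc _ y, map_mul]
        exact mul_lt_one_of_lt_of_le hs hvsq
      have h2 : y ^ q = x - (x - y ^ q) := by ring
      rw [h2, Valuation.map_sub_eq_of_lt_left _ (by rwa [hx]), hx]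
    have hyq0 : y ^ q ≠ 0 := (Valuation.ne_zero_iff O.valuation).1 (by rw [hy1]; exact one_ne_zero)
    have h1 := hs1 (s ^ (q - 2) * y * l / y ^ q) (by rwa [map_div₀, hy1, div_one])
    convert powSet.mul_mem ⟨hyq0, y, rfl⟩ h1 using 1
    field_simp
    rw [hsq] at hyl
    linear_combination hyl
  have hdiv : ∀ x, O.valuation x ≤ 1 → O.valuation s ≤ O.valuation x → x ∈ powSet K q := by
    intro x hx hsx
    obtain ⟨y, w, hw, hyw⟩ := exists_pow_eq_mul_unit hq hs0 hs h hx hsx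
    have hx0 : x ≠ 0 := (Valuation.ne_zero_iff O.valuation).1 (lt_of_lt_of_le hvs hsx).ne'
    have hwP := hunit w hw
    rw [← powSet.mul_mem_iff_right hwP, ← hyw]
    exact ⟨hyw ▸ mul_ne_zero hx0 hwP.1, y, rfl⟩
  have hsP : s ∈ powSet K q := hdiv s hs.le le_rfl
  -- Dividing repeatedly by the `q`-th power s reduces to values between v(s) and 1. Units of O[1/s]
  -- become such elements after multiplication by a power of s, and the maximal ideal of O[1/s] lies
  -- in sO.
  have hall : ∀ k : ℕ, ∀ x, O.valuation x ≤ 1 → O.valuation s ^ k ≤ O.valuation x →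
      x ∈ powSet K q := by
    intro k
    induction k with
    | zero =>
      intro x hx hx'
      exact hunit x (le_antisymm hx (by simpa using hx'))
    | succ k ih =>
      intro x hx hx'
      rcases le_total (O.valuation s) (O.valuation x) with h1 | h1
      · exact hdiv x hx h1
      · have h2 := ih (x / s) (by rw [map_div₀]; exact div_le_one_of_le₀ h1 zero_le) (by
          rwa [map_div₀, le_div_iff₀ hvs, ← pow_succ])
        have := powSet.mul_mem h2 hsP
        rwa [div_mul_cancel₀ _ hs0] at this
  refine ⟨O.invAdjoin hs.le, fun m hm => ?_, fun x hx => ?_⟩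
  · have h1 : O.valuation (m / s) ≤ 1 := by
      by_contra! h2
      have hm0 : m ≠ 0 := by
        rintro rfl
        simp at h2
      have h3 : m⁻¹ ∈ O.invAdjoin hs.le := by
        refine ⟨1, ?_⟩
        rw [pow_one, ← div_eq_mul_inv, ← inv_div, ← O.valuation_le_one_iff, map_inv₀]
        exact inv_le_one_of_one_le₀ h2.le
      rw [← ValuationSubring.valuation_le_one_iff, map_inv₀] at h3
      exact absurd hm (not_lt.2
        ((inv_le_one₀ (zero_lt_iff.2 ((Valuation.ne_zero_iff _).2 hm0))).1 h3))
    have := hs1 _ h1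
    rwa [mul_div_cancel₀ _ hs0] at this
  · have hx0 : x ≠ 0 := fun h0 => by simp [h0] at hx
    obtain ⟨n, hn⟩ := (ValuationSubring.valuation_le_one_iff _ _).1 hx.le
    obtain ⟨k, hk⟩ := (ValuationSubring.valuation_le_one_iff (O.invAdjoin hs.le) x⁻¹).1
      (by rw [map_inv₀, hx, inv_one])
    have h1 := hall (n + k) (s ^ n * x) ((O.valuation_le_one_iff _).2 hn) (by
      rw [← O.valuation_le_one_iff, map_mul, map_inv₀, ← div_eq_mul_inv, div_le_one₀
        (zero_lt_iff.2 ((Valuation.ne_zero_iff _).2 hx0)), map_pow] at hk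
      rw [map_mul, map_pow, pow_add]
      exact mul_le_mul_right hk _)
    have hsn : s ^ n ∈ powSet K q := by
      obtain ⟨-, y, hy⟩ := hsP
      exact ⟨pow_ne_zero _ hs0, y ^ n, by rw [← hy]; ring⟩
    exact (powSet.mul_mem_iff hsn).1 h1

/-- Improves the denominator r^q by the factor ρ^q, of value v(s). Approximate x/`kummerLead` by y^q
and set z = y/(rρ). Then x/(rρ)^q = F(z) + e/r^q with e integral, and with c = 1 + (1 - ζ)z the
element becomes c^q(1 + π(e/c^q)/r^q). -/
theorem kummerPi_div_mem_step (hq : q.Prime) (hζ : IsPrimitiveRoot ζ q) {s ρ w : K} (hs0 : s ≠ 0)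
    (hs : O.valuation s < 1) (hw : O.valuation w = 1) (hρ : ρ ^ q = s * w)
    (h : ∀ u, O.valuation u ≤ 1 → ∃ y l, O.valuation y ≤ 1 ∧ O.valuation l ≤ 1 ∧
      u - y ^ q = s ^ (q - 1) * y * l)
    (hs1 : ¬ ∀ x, O.valuation x ≤ 1 → 1 + s * x ∈ powSet K q) {r : K}
    (hrs : O.valuation r ≤ O.valuation s) (hr0 : r ≠ 0)
    (hr : ∀ x, O.valuation x ≤ 1 → 1 + kummerPi q ζ * (x / r ^ q) ∈ powSet K q) :
    ∀ x, O.valuation x ≤ 1 → 1 + kummerPi q ζ * (x / (r * ρ) ^ q) ∈ powSet K q := by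
  have hpi := kummerPi_ne_zero hq hζ
  have hlam := one_sub_ne_zero_of_isPrimitiveRoot hq hζ
  have hlead := kummerLead_ne_zero hq hζ
  have hvlead := valuation_kummerLead O hq hζ
  have hq1 : q - 1 ≠ 0 := Nat.sub_ne_zero_of_lt hq.one_lt
  have hpos : ∀ {x : K}, x ≠ 0 → 0 < O.valuation x := fun hx =>
    zero_lt_iff.2 ((Valuation.ne_zero_iff _).2 hx)
  have hρ0 : ρ ≠ 0 := by
    rintro rfl
    rw [zero_pow hq.ne_zero] at hρ
    rcases mul_eq_zero.1 hρ.symm with h0 | h0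
    · exact hs0 h0
    · simp [h0] at hw
  have hvρ : O.valuation ρ ^ q = O.valuation s := by rw [← map_pow, hρ, map_mul, hw, mul_one]
  have hvρ1 : O.valuation ρ ≤ 1 := by
    by_contra! hcon
    have := one_lt_pow₀ hcon hq.ne_zero
    rw [hvρ] at this
    exact absurd hs (not_lt.2 this.le)
  -- Otherwise v(sr^q) = v(rρ)^q ≤ v(π), so `hr` would already cover every 1 + sx. The strict
  -- inequality makes c a unit.
  have hlr : O.valuation (1 - ζ) < O.valuation (r * ρ) := by
    by_contra! hcon
    refine hs1 fun x hx => ?_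
    have h1 := hr (s * x * r ^ q / kummerPi q ζ) (by
      rw [map_div₀, div_le_one₀ (hpos hpi), valuation_kummerPi O hq hζ, map_mul, map_mul, map_pow,
        ← hvρ, mul_right_comm, ← mul_pow, mul_comm (O.valuation ρ), ← map_mul]
      exact (mul_le_of_le_one_right' hx).trans (pow_le_pow_left₀ zero_le hcon q))
    convert h1 using 1
    field_simp
  intro x hx
  obtain ⟨y, l, hy, hl, hyl⟩ := h (x / kummerLead q ζ) (by rwa [map_div₀, hvlead, div_one])
  have hlz : O.valuation ((1 - ζ) * (y / (r * ρ))) < 1 := by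
    rw [← mul_div_assoc, map_div₀, div_lt_one₀ (hpos (mul_ne_zero hr0 hρ0)), map_mul]
    exact (mul_le_of_le_one_right' hy).trans_lt hlr
  have htail := valuation_kummerTail_le O (q := q) hlz.le
  have hF := kummerMap_eq hq hζ (y / (r * ρ))
  have hc := one_add_kummerPi_mul_kummerMap hq hζ (y / (r * ρ))
  have hvc := O.valuation_one_add hlz
  set z := y / (r * ρ) with hz
  set c := 1 + (1 - ζ) * z
  have hc0 : c ≠ 0 := fun h0 => by simp [h0] at hvc
  set e := r ^ q * (-(z * kummerTail q ζ z) +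
    kummerLead q ζ * (s ^ (q - 1) * y * l) / (r * ρ) ^ q) with he
  have hve : O.valuation e ≤ 1 := by
    rw [he, mul_add]
    refine Valuation.map_add_le _ ?_ ?_
    · have h1 : r ^ q * -(z * kummerTail q ζ z) = -(r ^ (q - 1) / ρ * (y * kummerTail q ζ z)) := by
        have h2 : r ^ q = r ^ (q - 1) * r := by rw [← pow_succ, Nat.sub_add_cancel hq.one_le]
        rw [hz, h2]
        field_simp
      rw [h1, Valuation.map_neg, map_mul, map_mul _ y]
      refine mul_le_one' ?_ (mul_le_one' hy htail)
      rw [map_div₀, div_le_one₀ (hpos hρ0), map_pow]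
      calc O.valuation r ^ (q - 1) ≤ O.valuation r := pow_le_of_le_one zero_le (hrs.trans hs.le) hq1
        _ ≤ O.valuation ρ ^ q := by rwa [hvρ]
        _ ≤ O.valuation ρ := pow_le_of_le_one zero_le hvρ1 hq.ne_zero
    · have h1 : r ^ q * (kummerLead q ζ * (s ^ (q - 1) * y * l) / (r * ρ) ^ q) =
          s ^ (q - 1) / ρ ^ q * (kummerLead q ζ * (y * l)) := by
        rw [mul_pow]
        field_simp
      rw [h1, map_mul, map_mul, hvlead, one_mul, map_mul]
      refine mul_le_one' ?_ (mul_le_one' hy hl)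
      rw [map_div₀, map_pow _ ρ, hvρ, div_le_one₀ (hpos hs0), map_pow]
      exact pow_le_of_le_one zero_le hs.le hq1
  have h1 := hr (e / c ^ q) (by rwa [map_div₀, map_pow, hvc, one_pow, div_one])
  convert powSet.mul_mem (powSet.pow_mem (q := q) hc0) h1 using 1
  have h2 : x / (r * ρ) ^ q = kummerMap q ζ z + e / r ^ q := by
    rw [he, mul_div_cancel_left₀ _ (pow_ne_zero _ hr0), hF, ← hyl, hz, div_pow]
    field_simp
    ring
  rw [h2, mul_add, ← add_assoc, hc]
  field_simp

/-- Sharpness of a maximal valuation ring `O` with `1 + q (1 - ζ) O` consisting of `q`-th powers. -/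
theorem exists_notMem_of_maximal (hq : q.Prime) (hζ : IsPrimitiveRoot ζ q)
    (hmax : ∀ O' : ValuationSubring K, O ≤ O' → (∀ x ∈ O', 1 + kummerPi q ζ * x ∈ powSet K q) →
      O' ≤ O)
    (hno : ∀ O' : ValuationSubring K, (∀ m, O'.valuation m < 1 → 1 + m ∈ powSet K q) →
      ¬ ∀ x, O'.valuation x = 1 → x ∈ powSet K q)
    {s : K} (hs0 : s ≠ 0) (hs : O.valuation s < 1) :
    ∃ u, O.valuation u ≤ 1 ∧ 1 + kummerPi q ζ * (u / s ^ q) ∉ powSet K q := by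
  by_contra! hcon
  have hpos : ∀ {x : K}, x ≠ 0 → 0 < O.valuation x := fun hx =>
    zero_lt_iff.2 ((Valuation.ne_zero_iff _).2 hx)
  have hSP := fun u hu => exists_pow_approx hq hζ hs0 hs hcon (u := u) hu
  by_cases hs1 : ∀ x, O.valuation x ≤ 1 → 1 + s * x ∈ powSet K q
  · obtain ⟨O', h1, h2⟩ := exists_units_mem_of_pow_approx hq hs0 hs hSP hs1
    exact hno O' h1 h2
  obtain ⟨ρ, w, hw, hρ⟩ := exists_pow_eq_mul_unit hq hs0 hs hSP hs.le le_rfl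
  have hvρ : O.valuation ρ ^ q = O.valuation s := by rw [← map_pow, hρ, map_mul, hw, mul_one]
  have hρ0 : ρ ≠ 0 := by
    rintro rfl
    rw [map_zero, zero_pow hq.ne_zero] at hvρ
    exact (hpos hs0).ne hvρ
  have hvρ1 : O.valuation ρ ≤ 1 := by
    by_contra! hcon
    have := one_lt_pow₀ hcon hq.ne_zero
    rw [hvρ] at this
    exact absurd hs (not_lt.2 this.le)
  have hind : ∀ n : ℕ, ∀ x, O.valuation x ≤ 1 →
      1 + kummerPi q ζ * (x / (s * ρ ^ n) ^ q) ∈ powSet K q := by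
    intro n
    induction n with
    | zero => simpa using hcon
    | succ n ih =>
      have := kummerPi_div_mem_step hq hζ hs0 hs hw hρ hSP hs1 (r := s * ρ ^ n) (by
        rw [map_mul, map_pow]
        exact mul_le_of_le_one_right' (pow_le_one₀ zero_le hvρ1))
        (mul_ne_zero hs0 (pow_ne_zero _ hρ0)) ih
      simpa only [pow_succ, mul_assoc] using this
  -- The denominators (sρ^n)^q have value v(s)^(q+n), so the property extends to O[1/s], against
  -- maximality.
  have hle := hmax (O.invAdjoin hs.le) (O.le_invAdjoin hs.le) (by
    rintro x ⟨n, hn⟩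
    rw [← O.valuation_le_one_iff, map_mul, map_pow] at hn
    have h1 := hind n (x * (s * ρ ^ n) ^ q) (by
      rw [map_mul, map_pow, map_mul, map_pow, mul_pow, ← pow_mul, mul_comm n, pow_mul, hvρ,
        mul_left_comm]
      refine mul_le_one' (pow_le_one₀ zero_le hs.le) ?_
      rwa [mul_comm])
    rwa [mul_div_cancel_right₀ _ (pow_ne_zero _ (mul_ne_zero hs0 (pow_ne_zero _ hρ0)))] at h1)
  have h1 : s⁻¹ ∈ O := hle ⟨1, by rw [pow_one, mul_inv_cancel₀ hs0]; exact O.one_mem⟩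
  rw [← O.valuation_le_one_iff, map_inv₀] at h1
  exact absurd hs (not_lt.2 ((inv_le_one₀ (hpos hs0)).1 h1))

/-- If 1 + 𝔪 consisted of `q`-th powers, sharpness would make v(1 - ζ) the largest value below 1.
Write 1 + (1 - ζ) = c^q with c = 1 + (1 - ζ)z. Integral z gives v(1 - ζ) ≤ v(1 - ζ)^q, and
non-integral z puts v(c - 1) strictly between v(1 - ζ) and 1. -/
theorem exists_notMem_small_of_sharp (hq : q.Prime) (hζ : IsPrimitiveRoot ζ q)
    (hlam1 : O.valuation (1 - ζ) < 1)
    (hA : ∀ s, s ≠ 0 → O.valuation s < 1 →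
      ∃ u, O.valuation u ≤ 1 ∧ 1 + kummerPi q ζ * (u / s ^ q) ∉ powSet K q) :
    ∃ b, O.valuation (kummerPi q ζ * b) < 1 ∧ 1 + kummerPi q ζ * b ∉ powSet K q := by
  by_contra! hcon
  have hpi := kummerPi_ne_zero hq hζ
  have hlam := one_sub_ne_zero_of_isPrimitiveRoot hq hζ
  have hpos : ∀ {x : K}, x ≠ 0 → 0 < O.valuation x := fun hx =>
    zero_lt_iff.2 ((Valuation.ne_zero_iff _).2 hx)
  have hsmall : ∀ s, O.valuation s < 1 → O.valuation s ≤ O.valuation (1 - ζ) := by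
    intro s hs
    by_contra! h
    have hs0 : s ≠ 0 := by
      rintro rfl
      simp at h
    obtain ⟨u, hu, hu'⟩ := hA s hs0 hs
    refine hu' (hcon _ ?_)
    rw [map_mul, map_div₀, map_pow, valuation_kummerPi O hq hζ, ← mul_div_assoc,
      div_lt_one₀ (pow_pos (hpos hs0) q)]
    exact (mul_le_of_le_one_right' hu).trans_lt (pow_lt_pow_left₀ h zero_le hq.ne_zero)
  have h1 := hcon ((1 - ζ) / kummerPi q ζ) (by rwa [mul_div_cancel₀ _ hpi])
  rw [mul_div_cancel₀ _ hpi] at h1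
  obtain ⟨-, c, hc⟩ := h1
  have hz : (1 - ζ) * ((c - 1) / (1 - ζ)) = c - 1 := mul_div_cancel₀ _ hlam
  have hF : kummerPi q ζ * kummerMap q ζ ((c - 1) / (1 - ζ)) = 1 - ζ := by
    have h1 := one_add_kummerPi_mul_kummerMap hq hζ ((c - 1) / (1 - ζ))
    rw [hz, add_sub_cancel, hc] at h1
    exact add_left_cancel h1
  set z := (c - 1) / (1 - ζ)
  have hF' := congrArg O.valuation hF
  rw [map_mul, valuation_kummerPi O hq hζ] at hF'
  have hlt : O.valuation (1 - ζ) ^ q < O.valuation (1 - ζ) := by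
    conv_rhs => rw [← pow_one (O.valuation (1 - ζ))]
    exact pow_lt_pow_right_of_lt_one₀ (hpos hlam) hlam1 hq.one_lt
  rcases le_or_gt (O.valuation z) 1 with h | h
  · refine absurd hF' (ne_of_lt (lt_of_le_of_lt (mul_le_of_le_one_right' ?_) hlt))
    exact (valuation_kummerMap_le O hq hζ h).trans h
  · rw [valuation_kummerMap_of_one_lt O hq hζ h, ← mul_pow, ← map_mul, hz] at hF'
    have h2 : O.valuation (c - 1) < 1 := by
      by_contra! h3
      have := one_le_pow₀ h3 (n := q)
      rw [hF'] at this
      exact absurd hlam1 (not_lt.2 this)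
    have h3 := hsmall _ h2
    rw [← hz, map_mul] at h3
    refine absurd h3 (not_le.2 ?_)
    exact lt_mul_of_one_lt_right (hpos hlam) h

/-- Definability of a maximal valuation ring `O` with `1 + q (1 - ζ) O` consisting of `q`-th
powers. -/
theorem definable_of_sharp (hq : q.Prime) (hζ : IsPrimitiveRoot ζ q)
    (hlam1 : O.valuation (1 - ζ) < 1)
    (hE : ∀ x, O.valuation x ≤ 1 → 1 + kummerPi q ζ * x ∈ powSet K q)
    (hA : ∀ s, s ≠ 0 → O.valuation s < 1 →
      ∃ u, O.valuation u ≤ 1 ∧ 1 + kummerPi q ζ * (u / s ^ q) ∉ powSet K q) :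
    IsRingDefinable (O : Set K) := by
  have hpi := kummerPi_ne_zero hq hζ
  have hlam := one_sub_ne_zero_of_isPrimitiveRoot hq hζ
  have hpos : ∀ {x : K}, x ≠ 0 → 0 < O.valuation x := fun hx =>
    zero_lt_iff.2 ((Valuation.ne_zero_iff _).2 hx)
  have hvpi := valuation_kummerPi O hq hζ
  set v := O.valuation with hv
  have hbig : ∀ b, 1 + kummerPi q ζ * b ∉ powSet K q → 1 < v b := fun b hb =>
    not_le.1 fun h => hb (hE b h)
  set Y : K → Set K := fun b => {z | 1 + kummerPi q ζ * (b ^ 2 / (b - kummerMap q ζ z)) ∉ powSet K q}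
    with hY
  have hY1 : ∀ b, 1 + kummerPi q ζ * b ∉ powSet K q → v (kummerPi q ζ * b) < 1 → ∀ z, v z ≤ 1 →
      z ∈ Y b := by
    intro b hb hpb z hz hmem
    refine hb ?_
    have hF := (valuation_kummerMap_le O hq hζ hz).trans hz
    have hb1 := hbig b hb
    have h1 : v (b - kummerMap q ζ z) = v b :=
      Valuation.map_sub_eq_of_lt_left _ (hF.trans_lt hb1)
    have hb0 : b ≠ 0 := fun h => by simp [h] at hb1
    have h0 : b - kummerMap q ζ z ≠ 0 := fun h => by
      rw [h, map_zero] at h1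
      exact (hpos hb0).ne h1
    have hunit := O.valuation_one_add hpb
    have hne : 1 + kummerPi q ζ * b ≠ 0 := fun h => by simp [h] at hunit
    -- Since b²/(b - F) = b + bF/(b - F), the element tested in `Y b` is 1 + πb times a `q`-th
    -- power.
    have h2 := hE (b * kummerMap q ζ z / (b - kummerMap q ζ z) / (1 + kummerPi q ζ * b)) (by
      rw [map_div₀, map_div₀, map_mul, h1, show v (1 + kummerPi q ζ * b) = 1 from hunit, div_one,
        mul_div_cancel_left₀ _ (hpos hb0).ne']
      exact hF)
    rw [← powSet.mul_mem_iff_right h2]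
    convert hmem using 1
    field_simp
    ring
  have hY2 : ∀ b, 1 < v b → ∀ z ∈ Y b, v z ^ q ≤ v b ^ 2 := by
    intro b hb z hz
    by_contra! hcon
    have hb2 : v b < v b ^ 2 := by
      conv_lhs => rw [← pow_one (v b)]
      exact pow_lt_pow_right₀ hb one_lt_two
    have hz1 : 1 < v z := by
      by_contra! h
      exact absurd (hb.trans hb2 |>.trans hcon) (not_lt.2 (pow_le_one₀ zero_le h))
    have hF := valuation_kummerMap_of_one_lt O hq hζ hz1
    refine hz (hE _ ?_)
    rw [map_div₀, map_pow, Valuation.map_sub_eq_of_lt_right]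
    · exact div_le_one_of_le₀ (hcon.le.trans_eq hF.symm) zero_le
    · exact (hb2.trans hcon).trans_eq hF.symm
  have hA' : ∀ x, x ∉ O → 1 < v x ∧ ∃ b, v b ≤ v x ^ q ∧ 1 + kummerPi q ζ * b ∉ powSet K q := by
    intro x hx
    refine ⟨not_le.1 fun h => hx ((O.valuation_le_one_iff x).1 h), ?_⟩
    have hx0 : x ≠ 0 := fun h => hx (h ▸ O.zero_mem)
    obtain ⟨u, hu, hu'⟩ := hA x⁻¹ (inv_ne_zero hx0) (O.valuation_inv_lt_one_of_notMem hx)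
    refine ⟨_, ?_, hu'⟩
    rw [inv_pow, div_inv_eq_mul, map_mul, map_pow]
    exact mul_le_of_le_one_left' hu
  have hYdef : ∀ {α : Type} (f g : (α → K) → K), RingDefFun f → RingDefFun g →
      RingDefPred fun w => g w ∈ Y (f w) := by
    intro α f g hf hg
    exact .not (.mem powSet.definable (.add (.const _) (.mul (.const _)
      (.div (.pow hf _) (.sub hf (.div (.sub (.pow (.add (.const _) (.mul (.const _)
        hg)) _) (.const _)) (.const _)))))))
  -- `Y b` contains O when πb ∈ 𝔪, and sharpness bounds it from outside once b is small. With such a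
  -- b₀, the definable condition b/b₀ ∈ `Y b₀` forces v(b) ≤ v(b₀)², so πb ∈ 𝔪, and it admits every
  -- b with v(b) ≤ v(b₀). The exponent 3 beats the 2 in `hY2`.
  by_cases hb0 : ∃ b, 1 + kummerPi q ζ * b ∉ powSet K q ∧ v (kummerPi q ζ * b ^ 2) < 1
  · obtain ⟨b₀, hb₀, hb₀'⟩ := hb0
    have hb₁ := hbig b₀ hb₀
    have hb₂ : v b₀ ≤ v b₀ ^ 2 := by
      conv_lhs => rw [← pow_one (v b₀)]
      exact pow_le_pow_right₀ hb₁.le one_le_two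
    have hb₀0 : b₀ ≠ 0 := fun h => by simp [h] at hb₁
    have hb₃ : v (kummerPi q ζ * b₀) < 1 := by
      rw [map_mul, map_pow] at hb₀'
      rw [map_mul]
      exact lt_of_le_of_lt (mul_le_mul_right hb₂ _) hb₀'
    have : (O : Set K) =
        {x | ∀ b, 1 + kummerPi q ζ * b ∉ powSet K q → b / b₀ ∈ Y b₀ → x ^ 3 ∈ Y b} := by
      ext x
      constructor
      · intro hx b hb hbY
        refine hY1 b hb ?_ _ ?_
        · have h1 := hY2 b₀ hb₁ _ hbY
          have h2 : v (b / b₀) ≤ v b₀ := by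
            by_contra! h
            refine absurd h1 (not_le.2 ?_)
            calc v b₀ ^ 2 < v (b / b₀) ^ 2 := pow_lt_pow_left₀ h zero_le two_ne_zero
              _ ≤ _ := pow_le_pow_right₀ (hb₁.trans h).le hq.two_le
          rw [map_div₀, div_le_iff₀ (hpos hb₀0), ← pow_two] at h2
          rw [map_mul, map_pow] at hb₀'
          rw [map_mul]
          exact lt_of_le_of_lt (mul_le_mul_right h2 _) hb₀'
        · rw [map_pow]
          exact pow_le_one₀ zero_le ((O.valuation_le_one_iff x).2 hx)
      · intro hx
        by_contra hxO
        obtain ⟨hx1, b, hbx, hb⟩ := hA' x hxO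
        have key : ∀ c, 1 < v c → v c ≤ v x ^ q → x ^ 3 ∉ Y c := by
          intro c hc hcx hmem
          have h1 := hY2 c hc _ hmem
          refine absurd (h1.trans (pow_le_pow_left₀ zero_le hcx 2)) (not_le.2 ?_)
          rw [map_pow, ← pow_mul, ← pow_mul]
          exact pow_lt_pow_right₀ hx1 (by have := hq.pos; omega)
        rcases le_total (v b) (v b₀) with h | h
        · refine key b (hbig b hb) hbx (hx b hb (hY1 b₀ hb₀ hb₃ _ ?_))
          rw [map_div₀]
          exact div_le_one_of_le₀ h zero_le
        · refine key b₀ hb₁ (h.trans hbx) (hx b₀ hb₀ (hY1 b₀ hb₀ hb₃ _ ?_))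
          rw [div_self hb₀0, map_one]
    rw [this]
    refine isRingDefinable_iff.2 (.all (.imp (.not ?_) (.imp ?_ ?_)))
    · exact .mem powSet.definable (.add (.const _) (.mul (.const _) (.proj _)))
    · exact hYdef _ _ (.const _) (.div (.proj _) (.const _))
    · exact hYdef _ _ (.proj _) (.pow (.proj _) _)
  · push Not at hb0
    obtain ⟨b₀, hb₀', hb₀⟩ := exists_notMem_small_of_sharp hq hζ hlam1 hA
    have hb₁ := hbig b₀ hb₀
    have : (O : Set K) = {x | x ^ 4 ∈ Y b₀} := by
      ext x
      constructor
      · intro hx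
        refine hY1 b₀ hb₀ hb₀' _ ?_
        rw [map_pow]
        exact pow_le_one₀ zero_le ((O.valuation_le_one_iff x).2 hx)
      · intro hx
        by_contra hxO
        obtain ⟨hx1, b, hbx, hb⟩ := hA' x hxO
        -- Without such a b₀, every x ∉ O is already large relative to 1 - ζ, so one set `Y b₀` with
        -- πb₀ ∈ 𝔪 suffices; x⁴ is used because its q-th power has value v(x²)^(2q).
        have h1 : 1 ≤ v (1 - ζ) * v x ^ 2 := by
          have h2 := hb0 b hb
          rw [map_mul, hvpi, map_pow] at h2
          have h3 : 1 ≤ (v (1 - ζ) * v x ^ 2) ^ q := by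
            refine h2.trans ?_
            rw [mul_pow, ← pow_mul, mul_comm 2, pow_mul]
            exact mul_le_mul_right (pow_le_pow_left₀ zero_le hbx 2) _
          by_contra! h4
          exact absurd (pow_lt_one₀ zero_le h4 hq.ne_zero) (not_lt.2 h3)
        have h2 := one_le_pow₀ h1 (n := 2 * q)
        have h3 := hY2 b₀ hb₁ _ hx
        have h4 : (v (1 - ζ) * v x ^ 2) ^ (2 * q) ≤ (v (kummerPi q ζ * b₀)) ^ 2 := by
          rw [map_mul, hvpi, mul_pow, mul_pow, ← pow_mul, ← pow_mul, mul_comm q 2]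
          refine mul_le_mul_right ?_ _
          convert h3 using 1
          rw [map_pow, ← pow_mul]
          congr 1
          ring
        exact absurd (h2.trans h4) (not_le.2 (pow_lt_one₀ zero_le hb₀' two_ne_zero))
    rw [this]
    exact isRingDefinable_iff.2 (hYdef _ _ (.const _) (.pow (.proj _) _))

end WildCase

/-! ### Zorn arguments and the final case distinction. -/

section Main

variable {K : Type*} [Field K] {q : ℕ} {ζ : K}

/-- The intersection of a chain of valuation rings. -/
def ValuationSubring.iInterChain (c : Set (ValuationSubring K)) (hc : IsChain (· ≤ ·) c) : ValuationSubring K where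
  carrier := {x | ∀ O ∈ c, x ∈ O}
  one_mem' O _ := O.one_mem
  zero_mem' O _ := O.zero_mem
  neg_mem' hx O hO := O.neg_mem _ (hx O hO)
  add_mem' hx hy O hO := O.add_mem _ _ (hx O hO) (hy O hO)
  mul_mem' hx hy O hO := O.mul_mem _ _ (hx O hO) (hy O hO)
  mem_or_inv_mem' x := by
    by_contra! hcon
    obtain ⟨O₁, h₁, hx₁⟩ : ∃ O ∈ c, x ∉ O := by
      by_contra! h
      exact hcon.1 h
    obtain ⟨O₂, h₂, hx₂⟩ : ∃ O ∈ c, x⁻¹ ∉ O := by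
      by_contra! h
      exact hcon.2 h
    rcases hc.total h₁ h₂ with h | h
    · exact hx₂ (h ((O₁.mem_or_inv_mem x).resolve_left hx₁))
    · exact hx₁ (h ((O₂.mem_or_inv_mem x).resolve_right hx₂))

/-- The union of a chain of valuation rings. -/
def ValuationSubring.iUnionChain (c : Set (ValuationSubring K)) (hc : IsChain (· ≤ ·) c)
    (O : ValuationSubring K) (hO : O ∈ c) : ValuationSubring K :=
  have key : ∀ {x y : K}, (∃ A ∈ c, x ∈ A) → (∃ A ∈ c, y ∈ A) → ∃ A ∈ c, x ∈ A ∧ y ∈ A := by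
    rintro x y ⟨A, hA, hx⟩ ⟨B, hB, hy⟩
    rcases hc.total hA hB with h | h
    · exact ⟨B, hB, h hx, hy⟩
    · exact ⟨A, hA, hx, h hy⟩
  O.ofLE
    { carrier := {x | ∃ A ∈ c, x ∈ A}
      one_mem' := ⟨O, hO, O.one_mem⟩
      zero_mem' := ⟨O, hO, O.zero_mem⟩
      neg_mem' := fun ⟨A, hA, hx⟩ => ⟨A, hA, A.neg_mem _ hx⟩
      add_mem' := fun hx hy => by
        obtain ⟨A, hA, hx, hy⟩ := key hx hy
        exact ⟨A, hA, A.add_mem _ _ hx hy⟩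
      mul_mem' := fun hx hy => by
        obtain ⟨A, hA, hx, hy⟩ := key hx hy
        exact ⟨A, hA, A.mul_mem _ _ hx hy⟩ }
    fun _ hx => ⟨O, hO, hx⟩

/-- The trivial ring is compatible. A non-zero non-unit m of the intersection of a chain has m⁻¹
outside some member, so m lies in the maximal ideal of that member. -/
theorem exists_minimal_kummerCompatible :
    ∃ O : ValuationSubring K, KummerCompatible q ζ O ∧ ∀ O' < O, ¬ KummerCompatible q ζ O' := by
  obtain ⟨O, -, hO⟩ := zorn_le_nonempty₀ (α := (ValuationSubring K)ᵒᵈ)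
    {O | KummerCompatible q ζ (OrderDual.ofDual O)} (by
      intro c hcs hc _ _
      have hc' : IsChain (· ≤ ·) (OrderDual.ofDual '' c : Set (ValuationSubring K)) := by
        rintro _ ⟨A, hA, rfl⟩ _ ⟨B, hB, rfl⟩ -
        exact (hc.total hA hB).symm
      refine ⟨OrderDual.toDual (ValuationSubring.iInterChain (OrderDual.ofDual '' c) hc'),
        ?_, fun A hA x hx => hx _ ⟨A, hA, rfl⟩⟩
      intro m hm
      change m ∈ (ValuationSubring.iInterChain (OrderDual.ofDual '' c) hc').nonunits at hm
      rw [ValuationSubring.mem_nonunits_iff_or] at hm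
      rcases hm with rfl | hm
      · simpa using powSet.one_mem
      · obtain ⟨A, hA, hmA⟩ : ∃ A ∈ c, m⁻¹ ∉ OrderDual.ofDual A := by
          by_contra! h
          exact hm (by rintro _ ⟨A, hA, rfl⟩; exact h A hA)
        exact hcs hA m (ValuationSubring.valuation_lt_one_of_inv_notMem _ hmA))
    (OrderDual.toDual ⊤) (by
      intro m hm
      change m ∈ (⊤ : ValuationSubring K).nonunits at hm
      rw [ValuationSubring.mem_nonunits_iff_or] at hm
      rcases hm with rfl | hm
      · simpa using powSet.one_mem
      · exact absurd (ValuationSubring.mem_top _) hm)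
  refine ⟨OrderDual.ofDual O, hO.prop, fun O' hO' hcomp => ?_⟩
  exact absurd (hO.le_of_ge (y := OrderDual.toDual O') hcomp hO'.le) (not_le_of_gt hO')

theorem exists_maximal_of_forall_mem {S : Set K} {O₀ : ValuationSubring K} (h : ∀ x ∈ O₀, x ∈ S) :
    ∃ O : ValuationSubring K, (∀ x ∈ O, x ∈ S) ∧
      ∀ O' : ValuationSubring K, O ≤ O' → (∀ x ∈ O', x ∈ S) → O' ≤ O := by
  obtain ⟨O, -, hO⟩ := zorn_le_nonempty₀ {O : ValuationSubring K | ∀ x ∈ O, x ∈ S} (by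
    intro c hcs hc y hy
    refine ⟨ValuationSubring.iUnionChain c hc y hy, ?_, fun A hA x hx => ⟨A, hA, hx⟩⟩
    rintro x ⟨A, hA, hx⟩
    exact hcs hA x hx) O₀ h
  exact ⟨O, hO.prop, fun O' hle hO' => hO.le_of_ge hO' hle⟩

/-- This is where the topology enters the choice of O. Over the trivial ring every non-zero element
is a unit, so the ring from `exists_subring` meets the hypotheses of `exists_kummerCompatible_lt`
directly; it omits -j⁻¹, since 1 + j(-j⁻¹) = 0. -/
theorem ne_top_of_isVFilter {F : Filter K} (hF : F.IsVFilter) (hq : q.Prime)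
    (hζ : IsPrimitiveRoot ζ q) (hneg : (-1 : K) ∈ powSet K q)
    (hT : ∀ᶠ x in F, 1 + x ∈ powSet K q) (hG : ∃ a : K, a ≠ 0 ∧ a ∉ powSet K q)
    {O : ValuationSubring K} (hmin : ∀ O' < O, ¬ KummerCompatible q ζ O') : O ≠ ⊤ := by
  rintro rfl
  have hpi := kummerPi_ne_zero hq hζ
  obtain ⟨a, ha0, ha⟩ := hG
  obtain ⟨R, ⟨d, hd0, hd⟩, j, hj0, hj⟩ := hF.exists_subring hq.ne_zero hneg hT ha0 ha
  have hunit : ∀ x : K, x ≠ 0 → (⊤ : ValuationSubring K).valuation x = 1 := by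
    intro x hx
    have h : ∀ y : K, (⊤ : ValuationSubring K).valuation y ≤ 1 := fun y =>
      (ValuationSubring.valuation_le_one_iff _ _).2 (ValuationSubring.mem_top y)
    refine le_antisymm (h x) ?_
    have := h x⁻¹
    rwa [map_inv₀, inv_le_one₀ (zero_lt_iff.2 ((Valuation.ne_zero_iff _).2 hx))] at this
  obtain ⟨O', hlt, hcomp⟩ := exists_kummerCompatible_lt hq hζ ⊤ R
    (fun m hm => by
      rcases eq_or_ne m 0 with rfl | hm0
      · exact zero_mem R
      · exact absurd (hunit m hm0) hm.ne)
    ⟨-j⁻¹, ValuationSubring.mem_top _, fun h => by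
      have := hj _ h
      rw [mul_neg, mul_inv_cancel₀ hj0, add_neg_cancel] at this
      exact powSet.zero_notMem this⟩
    (hunit d hd0) hd (hunit (j / kummerPi q ζ) (div_ne_zero hj0 hpi)) (fun x hx => by
      rw [← mul_assoc, mul_div_cancel₀ _ hpi]
      exact hj x hx)
  exact hmin O' hlt hcomp

/-- A field whose proper subgroup of `q`-th powers is open with respect to a V-topology has a
non-trivial definable valuation ring. -/
theorem exists_definable_valuationSubring {F : Filter K} (hF : F.IsVFilter) (hq : q.Prime)
    (hζ : IsPrimitiveRoot ζ q) (hneg : (-1 : K) ∈ powSet K q)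
    (hT : ∀ᶠ x in F, 1 + x ∈ powSet K q) (hG : ∃ a : K, a ≠ 0 ∧ a ∉ powSet K q) :
    ∃ W : ValuationSubring K, W ≠ ⊤ ∧ IsRingDefinable (W : Set K) := by
  have hpi := kummerPi_ne_zero hq hζ
  obtain ⟨O, hO, hmin⟩ := exists_minimal_kummerCompatible (K := K) (q := q) (ζ := ζ)
  have htop := ne_top_of_isVFilter hF hq hζ hneg hT hG hmin
  rcases (valuation_kummerPi_le O hq hζ).eq_or_lt with h1 | h1
  · by_cases hU : ∀ x, O.valuation x = 1 → x ∈ powSet K q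
    · refine exists_definable_of_units O (fun m hm => ?_) hU hG
      have := hO (m / kummerPi q ζ) (by rwa [map_div₀, h1, div_one])
      rwa [mul_div_cancel₀ _ hpi] at this
    · push Not at hU
      obtain ⟨a, ha1, ha⟩ := hU
      exact ⟨O, htop, definable_of_unit_notMem hq hζ hneg O hO hmin h1 ha1 ha⟩
  · have hlam : ∀ O' : ValuationSubring K, O'.valuation (kummerPi q ζ) < 1 →
        O'.valuation (1 - ζ) < 1 := by
      intro O' h
      rw [valuation_kummerPi O' hq hζ] at h
      by_contra! hcon
      exact absurd h (not_lt.2 (one_le_pow₀ hcon))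
    by_cases hE : ∀ x ∈ O, 1 + kummerPi q ζ * x ∈ powSet K q
    swap
    · push Not at hE
      obtain ⟨b, hb, hbP⟩ := hE
      exact ⟨O, htop, definable_of_artinSchreier hq hζ O hO hmin (hlam O h1) hb hbP⟩
    by_cases hno : ∀ O' : ValuationSubring K, (∀ m, O'.valuation m < 1 → 1 + m ∈ powSet K q) →
      ¬ ∀ x, O'.valuation x = 1 → x ∈ powSet K q
    swap
    · push Not at hno
      obtain ⟨O', hM, hU⟩ := hno
      exact exists_definable_of_units O' hM hU hG
    obtain ⟨W, hW, hmax⟩ := exists_maximal_of_forall_mem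
      (S := {x | 1 + kummerPi q ζ * x ∈ powSet K q}) hE
    have hpiW : W.valuation (kummerPi q ζ) < 1 := by
      refine W.valuation_lt_one_of_inv_notMem fun h => ?_
      have h2 : 1 + kummerPi q ζ * -(kummerPi q ζ)⁻¹ ∈ powSet K q := hW _ (W.neg_mem _ h)
      rw [mul_neg, mul_inv_cancel₀ hpi, add_neg_cancel] at h2
      exact powSet.zero_notMem h2
    refine ⟨W, ?_, ?_⟩
    · rintro rfl
      have h2 : (⊤ : ValuationSubring K).valuation (kummerPi q ζ)⁻¹ ≤ 1 :=
        (ValuationSubring.valuation_le_one_iff _ _).2 (ValuationSubring.mem_top _)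
      rw [map_inv₀, inv_le_one₀ (zero_lt_iff.2 ((Valuation.ne_zero_iff _).2 hpi))] at h2
      exact absurd hpiW (not_lt.2 h2)
    · refine definable_of_sharp hq hζ (hlam W hpiW)
        (fun x hx => hW x ((W.valuation_le_one_iff x).1 hx)) fun s hs0 hs => ?_
      exact exists_notMem_of_maximal hq hζ hmax hno hs0 hs

end Main

theorem mainTheorem3 {K : Type u} [Field K] (q : ℕ) (hq : q.Prime) (hchar : ringChar K ≠ q)
    (heucl : q = 2 → ¬ IsEuclideanField K) (hzeta : ∃ ζ : K, IsPrimitiveRoot ζ q)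
    (G : Subgroup Kˣ) (hG : G = powSubgroup K q) (hG_ne : G ≠ ⊤) (hneg : -1 ∈ G)
    (T : Set K) (hT : T = subgroupAddOne G)
    (V1 : ({0} : Set K) ∉ zeroNhdFamily G)
    (V3 : ∃ V ∈ zeroNhdFamily G, V - V ⊆ T)
    (V4 : ∃ V ∈ zeroNhdFamily G, V * V ⊆ T)
    (V6 : ∃ V ∈ zeroNhdFamily G, ∀ x y : K, x * y ∈ V → x ∈ T ∨ y ∈ T) :
    ∃ (Γ : Type u) (_ : LinearOrderedCommGroupWithZero Γ) (v : Valuation K Γ),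
      v.IsNontrivial ∧ IsDefinableValuation v := by
  obtain ⟨ζ, hζ⟩ := hzeta
  have hq0 := hq.ne_zero
  subst hG hT
  have hneg' : (-1 : K) ∈ powSet K q := by
    simpa using (mem_powSubgroup_iff hq0).1 hneg
  have hF := isVFilter_zeroNhdFilter hneg V1 V3 V4 V6
  -- -x ∈ T means that -x - 1 is a `q`-th power, and multiplying by -1 gives 1 + x.
  have hopen : ∀ᶠ x in zeroNhdFilter (powSubgroup K q), 1 + x ∈ powSet K q := by
    have h1 := hF.neg.eventually (smul_mem_zeroNhdFilter (G := powSubgroup K q) 1)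
    filter_upwards [h1] with x hx
    rw [one_smul] at hx
    have h2 := powSet.mul_mem hneg' ((mem_subgroupAddOne_powSubgroup_iff hq0).1 hx)
    convert h2 using 1
    ring
  have hproper : ∃ a : K, a ≠ 0 ∧ a ∉ powSet K q := by
    by_contra! hcon
    refine hG_ne ((Subgroup.eq_top_iff' _).2 fun g => ?_)
    exact (mem_powSubgroup_iff hq0).2 (hcon g g.ne_zero)
  obtain ⟨W, hW, hdef⟩ := exists_definable_valuationSubring hF hq hζ hneg' hopen hproper
  refine ⟨W.ValueGroup, inferInstance, W.valuation, ?_, ?_⟩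
  · by_contra h
    exact hW (W.eq_top_iff.2 h)
  · rw [IsDefinableValuation, W.valuationSubring_valuation]
    exact hdef
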